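/- Let $p,n\ge 1$ be integers, let $F$ be a field containing a primitive $p$-th root of unity, and let $\Gamma$ be a quiver without loops and without multiple directed edges, with (possibly infinite) vertex set $K$. For $k,k'\in K$ write $k\to k'$ (equivalently $k'\leftarrow k$) if $(k,k')$ is an edge and $(k',k)$ is not, $k\leftrightarrows k'$ if both are edges, and $k\not-\,k'$ if $k\ne k'$ and neither is an edge. For a finitely supported $\alpha\in\mathbb N^{(K)}$ with $\sum_k\alpha_k=n$, let $K^\alpha$ be the set of $\mathbf k\in K^n$ having, for every $k\in K$, exactly $\alpha_k$ components equal to $k$. The quiver Hecke algebra $\mathcal R_\alpha(\Gamma)$ is the unital associative $F$-algebra with generators $e(\mathbf k)$ ($\mathbf k\in K^\alpha$), $y_1,\dots,y_n$, $\psi_1,\dots,\psi_{n-1}$ and relations $$\textstyle\sum_{\mathbf k}e(\mathbf k)=1,\quad e(\mathbf k)e(\mathbf k')=\delta_{\mathbf k,\mathbf k'}e(\mathbf k),\quad y_ae(\mathbf k)=e(\mathbf k)y_a,\quad \psi_ae(\mathbf k)=e(s_a\cdot\mathbf k)\psi_a,\quad y_ay_b=y_by_a,$$ $$\psi_ay_b=y_b\psi_a\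 (b\ne a,a+1),\qquad \psi_a\psi_b=\psi_b\psi_a\ (|a-b|>1),$$ $$\psi_ay_{a+1}e(\mathbf k)=(y_a\psi_a+\delta_{k_a,k_{a+1}})e(\mathbf k),\qquad y_{a+1}\psi_ae(\mathbf k)=(\psi_ay_a+\delta_{k_a,k_{a+1}})e(\mathbf k),$$ $$\psi_a^2e(\mathbf k)=\begin{cases}0&k_a=k_{a+1},\\ e(\mathbf k)&k_a\not-\,k_{a+1},\\ (y_{a+1}-y_a)e(\mathbf k)&k_a\to k_{a+1},\\ (y_a-y_{a+1})e(\mathbf k)&k_a\leftarrow k_{a+1},\\ (y_{a+1}-y_a)(y_a-y_{a+1})e(\mathbf k)&k_a\leftrightarrows k_{a+1},\end{cases}$$ $$\psi_{a+1}\psi_a\psi_{a+1}e(\mathbf k)=\begin{cases}(\psi_a\psi_{a+1}\psi_a-1)e(\mathbf k)&k_{a+2}=k_a\to k_{a+1},\\ (\psi_a\psi_{a+1}\psi_a+1)e(\mathbf k)&k_{a+2}=k_a\leftarrow k_{a+1},\\ (\psi_a\psi_{a+1}\psi_a+2y_{a+1}-y_a-y_{a+2})e(\mathbf k)&k_{a+2}=k_a\leftrightarrows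 k_{a+1},\\ \psi_a\psi_{a+1}\psi_ae(\mathbf k)&\text{otherwise,}\end{cases}$$ where $s_a\cdot\mathbf k$ is $\mathbf k$ with its components $a$ and $a+1$ exchanged. For a finitely supported weight $\Lambda\in\mathbb N^{(K)}$, the cyclotomic quotient $\mathcal R^\Lambda_\alpha(\Gamma)$ is the quotient of $\mathcal R_\alpha(\Gamma)$ by the two-sided ideal generated by the $y_1^{\Lambda_{k_1}}e(\mathbf k)$, $\mathbf k\in K^\alpha$. Let $\sigma$ be an automorphism of $\Gamma$ with $\sigma^m(k)\ne k=\sigma^p(k)$ for all $k\in K$ and $0<m<p$, and assume that $\Lambda$ is $\sigma$-stable: $\Lambda_k=\Lambda_{\sigma(k)}$ for all $k$. Put $(\sigma\cdot\alpha)_k=\alpha_{\sigma^{-1}(k)}$, let $[\alpha]$ be the orbit of $\alpha$ under $\langle\sigma\rangle$, and set $K^{[\alpha]}=\bigsqcup_{\beta\in[\alpha]}K^\beta$, $\mathcal R_{[\alpha]}(\Gamma)=\bigoplus_{\beta\in[\alpha]}\mathcal R_\beta(\Gamma)$, $\mathcal R^\Lambda_{[\alpha]}(\Gamma)=\bigoplus_{\beta\in[\alpha]}\mathcal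 R^\Lambda_\beta(\Gamma)$, with canonical projection $\pi:\mathcal R_{[\alpha]}(\Gamma)\to\mathcal R^\Lambda_{[\alpha]}(\Gamma)$. The rule $e(\mathbf k)\mapsto e(\sigma(\mathbf k))$, $y_a\mapsto y_a$, $\psi_a\mapsto\psi_a$ defines an automorphism $\sigma$ of $\mathcal R_{[\alpha]}(\Gamma)$ which induces one of $\mathcal R^\Lambda_{[\alpha]}(\Gamma)$; let $\mathcal R_{[\alpha]}(\Gamma)^\sigma$ and $\mathcal R^\Lambda_{[\alpha]}(\Gamma)^\sigma$ be the fixed point subalgebras. Let $K^{[\alpha]}_\sigma$ be the quotient of $K^{[\alpha]}$ by the equivalence relation generated by $\mathbf k\sim\sigma(\mathbf k)$, and for $\gamma\in K^{[\alpha]}_\sigma$ put $e(\gamma)=\sum_{\mathbf k\in\gamma}e(\mathbf k)$. The class $s_a\cdot\gamma$, the conditions $\gamma_a=\gamma_b$, $\gamma_a\to\gamma_b$, etc., and the integer $\Lambda_{\gamma_1}$ are defined through any representative of $\gamma$. Let $(\mathcal R_{[\alpha]}(\Gamma)^\sigma)^\Lambda$ be the quotient of $\mathcal R_{[\alpha]}(\Gamma)^\sigma$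 by the two-sided ideal generated by the $y_1^{\Lambda_{\gamma_1}}e(\gamma)$, $\gamma\in K^{[\alpha]}_\sigma$. **Theorem.** (1) There is an isomorphism of $F$-algebras $(\mathcal R_{[\alpha]}(\Gamma)^\sigma)^\Lambda\simeq\mathcal R^\Lambda_{[\alpha]}(\Gamma)^\sigma$, sending the class of $h\in\mathcal R_{[\alpha]}(\Gamma)^\sigma$ to $\pi(h)$. (2) $\mathcal R^\Lambda_{[\alpha]}(\Gamma)^\sigma$ is presented, as a unital associative $F$-algebra, by the generators $e(\gamma)$ ($\gamma\in K^{[\alpha]}_\sigma$), $y_1,\dots,y_n$, $\psi_1,\dots,\psi_{n-1}$ (mapping to the elements $\pi(e(\gamma))$, $\pi(y_a)$, $\pi(\psi_a)$), subject to all the relations of the quiver Hecke algebra displayed above with $\mathbf k\in K^\alpha$ replaced by $\gamma\in K^{[\alpha]}_\sigma$ (and $k_a$ by $\gamma_a$), together with $y_1^{\Lambda_{\gamma_1}}e(\gamma)=0$ for all $\gamma\in K^{[\alpha]}_\sigma$. -/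

import Mathlib

noncomputable section

namespace QuiverHecke

universe u v w

/-! ### Algebras presented by quiver-Hecke-type generators and relations

The relations defining a quiver Hecke algebra on `n + 1` strands only involve, for an index `x` of
an idempotent, the index `s_a · x` and the truth values of `x_a = x_b` and
"`(x_a, x_b)` is an edge". Strands are numbered by `Fin (n + 1)`; the generator `ψ_a`, for
`a : Fin n`, involves the strands `a.castSucc` (that is, `a`) and `a.succ` (that is, `a + 1`). -/

/-- What is needed to write the quiver Hecke relations for idempotents indexed by `X`:
`swap a x` is `s_a · x`, `same a b x` is `x_a = x_b`, and `edge a b x` says that `(x_a, x_b)` is an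
edge of the quiver. It is used below for two sets only: the tuples `K^β`, and the classes of
tuples modulo an automorphism of the quiver. -/
structure StrandData (n : ℕ) (X : Type u) where
  swap : Fin n → X → X
  same : Fin (n + 1) → Fin (n + 1) → X → Prop
  edge : Fin (n + 1) → Fin (n + 1) → X → Prop

namespace StrandData
variable {n : ℕ} {X : Type u} (D : StrandData n X)

/-- `x_a → x_b` : there is an edge from `x_a` to `x_b` and none from `x_b` to `x_a`. -/
def arrow (a b : Fin (n + 1)) (x : X) : Prop := D.edge a b x ∧ ¬ D.edge b a x

/-- `x_a ⇆ x_b` : there are edges in both directions. -/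
def darrow (a b : Fin (n + 1)) (x : X) : Prop := D.edge a b x ∧ D.edge b a x

/-- There is no edge between `x_a` and `x_b`, in either direction. -/
def noEdge (a b : Fin (n + 1)) (x : X) : Prop := ¬ D.edge a b x ∧ ¬ D.edge b a x

end StrandData

/-- The generators `e(x)`, `y_a`, `ψ_a`. -/
inductive Gen (n : ℕ) (X : Type u) : Type u
  | e (x : X) : Gen n X
  | y (a : Fin (n + 1)) : Gen n X
  | psi (a : Fin n) : Gen n X

section Presentation

variable (F : Type v) [Field F] {n : ℕ} {X : Type u}

/-- The free generator `e(x)`. -/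
abbrev fe (x : X) : FreeAlgebra F (Gen n X) := FreeAlgebra.ι F (Gen.e x)
/-- The free generator `y_a`. -/
abbrev fy (a : Fin (n + 1)) : FreeAlgebra F (Gen n X) := FreeAlgebra.ι F (Gen.y a)
/-- The free generator `ψ_a`. -/
abbrev fpsi (a : Fin n) : FreeAlgebra F (Gen n X) := FreeAlgebra.ι F (Gen.psi a)

/-- The defining relations of a quiver Hecke algebra (`Rel F D l r` means that `l = r` is one of
them). -/
inductive Rel [Fintype X] (D : StrandData n X) :
    FreeAlgebra F (Gen n X) → FreeAlgebra F (Gen n X) → Prop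
  | sum_e : Rel D (∑ x : X, fe F x) 1
  | e_idem (x : X) : Rel D (fe F x * fe F x) (fe F x)
  | e_orth (x x' : X) (h : x ≠ x') : Rel D (fe F x * fe F x') 0
  | y_e (a : Fin (n + 1)) (x : X) : Rel D (fy F a * fe F x) (fe F x * fy F a)
  | psi_e (a : Fin n) (x : X) : Rel D (fpsi F a * fe F x) (fe F (D.swap a x) * fpsi F a)
  | y_y (a b : Fin (n + 1)) : Rel D (fy F a * fy F b) (fy F b * fy F a)
  | psi_y (a : Fin n) (b : Fin (n + 1)) (h₁ : b ≠ a.castSucc) (h₂ : b ≠ a.succ) :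
      Rel D (fpsi F a * fy F b) (fy F b * fpsi F a)
  | psi_psi (a b : Fin n) (h : a.val + 1 < b.val ∨ b.val + 1 < a.val) :
      Rel D (fpsi F a * fpsi F b) (fpsi F b * fpsi F a)
  | psi_y_succ_same (a : Fin n) (x : X) (h : D.same a.castSucc a.succ x) :
      Rel D (fpsi F a * fy F a.succ * fe F x) ((fy F a.castSucc * fpsi F a + 1) * fe F x)
  | psi_y_succ_ne (a : Fin n) (x : X) (h : ¬ D.same a.castSucc a.succ x) :
      Rel D (fpsi F a * fy F a.succ * fe F x) (fy F a.castSucc * fpsi F a * fe F x)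
  | y_succ_psi_same (a : Fin n) (x : X) (h : D.same a.castSucc a.succ x) :
      Rel D (fy F a.succ * fpsi F a * fe F x) ((fpsi F a * fy F a.castSucc + 1) * fe F x)
  | y_succ_psi_ne (a : Fin n) (x : X) (h : ¬ D.same a.castSucc a.succ x) :
      Rel D (fy F a.succ * fpsi F a * fe F x) (fpsi F a * fy F a.castSucc * fe F x)
  | psi_sq_same (a : Fin n) (x : X) (h : D.same a.castSucc a.succ x) :
      Rel D (fpsi F a ^ 2 * fe F x) 0
  | psi_sq_noEdge (a : Fin n) (x : X) (h₁ : ¬ D.same a.castSucc a.succ x)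
      (h₂ : D.noEdge a.castSucc a.succ x) :
      Rel D (fpsi F a ^ 2 * fe F x) (fe F x)
  | psi_sq_right (a : Fin n) (x : X) (h : D.arrow a.castSucc a.succ x) :
      Rel D (fpsi F a ^ 2 * fe F x) ((fy F a.succ - fy F a.castSucc) * fe F x)
  | psi_sq_left (a : Fin n) (x : X) (h : D.arrow a.succ a.castSucc x) :
      Rel D (fpsi F a ^ 2 * fe F x) ((fy F a.castSucc - fy F a.succ) * fe F x)
  | psi_sq_both (a : Fin n) (x : X) (h : D.darrow a.castSucc a.succ x) :
      Rel D (fpsi F a ^ 2 * fe F x)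
        ((fy F a.succ - fy F a.castSucc) * (fy F a.castSucc - fy F a.succ) * fe F x)
  -- In the braid relations `b = a + 1`, so the strands `a, a + 1, a + 2` are
  -- `a.castSucc`, `a.succ` and `b.succ`.
  | braid_right (a b : Fin n) (hb : b.val = a.val + 1) (x : X)
      (h₁ : D.same b.succ a.castSucc x) (h₂ : D.arrow a.castSucc a.succ x) :
      Rel D (fpsi F b * fpsi F a * fpsi F b * fe F x)
        ((fpsi F a * fpsi F b * fpsi F a - 1) * fe F x)
  | braid_left (a b : Fin n) (hb : b.val = a.val + 1) (x : X)
      (h₁ : D.same b.succ a.castSucc x) (h₂ : D.arrow a.succ a.castSucc x) :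
      Rel D (fpsi F b * fpsi F a * fpsi F b * fe F x)
        ((fpsi F a * fpsi F b * fpsi F a + 1) * fe F x)
  | braid_both (a b : Fin n) (hb : b.val = a.val + 1) (x : X)
      (h₁ : D.same b.succ a.castSucc x) (h₂ : D.darrow a.castSucc a.succ x) :
      Rel D (fpsi F b * fpsi F a * fpsi F b * fe F x)
        ((fpsi F a * fpsi F b * fpsi F a + 2 * fy F a.succ - fy F a.castSucc - fy F b.succ)
          * fe F x)
  | braid_otherwise (a b : Fin n) (hb : b.val = a.val + 1) (x : X)
      (h : ¬ (D.same b.succ a.castSucc x ∧ ¬ D.noEdge a.castSucc a.succ x)) :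
      Rel D (fpsi F b * fpsi F a * fpsi F b * fe F x)
        (fpsi F a * fpsi F b * fpsi F a * fe F x)

/-- The defining relations of a quiver Hecke algebra together with the cyclotomic relations
`y_1 ^ (lvl x) e(x) = 0`, where `y_1` is the first of the `y_a`. -/
inductive CycloRel [Fintype X] (D : StrandData n X) (lvl : X → ℕ) :
    FreeAlgebra F (Gen n X) → FreeAlgebra F (Gen n X) → Prop
  | affine (l r : FreeAlgebra F (Gen n X)) (h : Rel F D l r) : CycloRel D lvl l r
  | cyclo (x : X) : CycloRel D lvl (fy F 0 ^ lvl x * fe F x) 0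

/-- The unital associative `F`-algebra with generators `e(x)`, `y_a`, `ψ_a` and the quiver Hecke
relations. -/
abbrev Pres [Fintype X] (D : StrandData n X) : Type _ := RingQuot (Rel F D)

/-- The unital associative `F`-algebra with generators `e(x)`, `y_a`, `ψ_a`, the quiver Hecke
relations and the cyclotomic relations. -/
abbrev CycloPres [Fintype X] (D : StrandData n X) (lvl : X → ℕ) : Type _ :=
  RingQuot (CycloRel F D lvl)

/-- A generator, seen in the presented algebra. -/
def Pres.gen [Fintype X] (D : StrandData n X) (g : Gen n X) : Pres F D :=
  RingQuot.mkAlgHom F (Rel F D) (FreeAlgebra.ι F g)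

/-- A generator, seen in the presented algebra. -/
def CycloPres.gen [Fintype X] (D : StrandData n X) (lvl : X → ℕ) (g : Gen n X) :
    CycloPres F D lvl :=
  RingQuot.mkAlgHom F (CycloRel F D lvl) (FreeAlgebra.ι F g)

variable {F}

/-- The relabelling of the generators by a bijection of the index sets. -/
def Gen.map {X' : Type u} (f : X → X') : Gen n X → Gen n X'
  | .e x => .e (f x)
  | .y a => .y a
  | .psi a => .psi a

/-- A bijection of index sets compatible with the strand data. -/
structure StrandIso {X' : Type u} (D : StrandData n X) (D' : StrandData n X') where
  toEquiv : X ≃ X'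
  swap : ∀ a x, toEquiv (D.swap a x) = D'.swap a (toEquiv x)
  same : ∀ a b x, D.same a b x ↔ D'.same a b (toEquiv x)
  edge : ∀ a b x, D.edge a b x ↔ D'.edge a b (toEquiv x)

theorem Rel.map {X' : Type u} [Fintype X] [Fintype X'] {D : StrandData n X}
    {D' : StrandData n X'} (f : StrandIso D D') {l r : FreeAlgebra F (Gen n X)}
    (h : Rel F D l r) :
    Rel F D' (FreeAlgebra.lift F (fun g => FreeAlgebra.ι F (g.map f.toEquiv)) l)
      (FreeAlgebra.lift F (fun g => FreeAlgebra.ι F (g.map f.toEquiv)) r) := by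
  cases h <;> simp only [map_sum, map_mul, map_one, map_zero, map_add, map_sub, map_pow, map_ofNat,
    FreeAlgebra.lift_ι_apply, Gen.map, f.swap]
  case sum_e =>
    rw [f.toEquiv.sum_comp (fun x => FreeAlgebra.ι F (Gen.e x : Gen n X'))]
    exact Rel.sum_e
  case e_idem x => exact Rel.e_idem _
  case e_orth x x' h => exact Rel.e_orth _ _ (fun hh => h (f.toEquiv.injective hh))
  case y_e a x => exact Rel.y_e _ _
  case psi_e a x => exact Rel.psi_e _ _
  case y_y a b => exact Rel.y_y _ _
  case psi_y a b h₁ h₂ => exact Rel.psi_y _ _ h₁ h₂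
  case psi_psi a b h => exact Rel.psi_psi _ _ h
  case psi_y_succ_same a x h => exact Rel.psi_y_succ_same _ _ ((f.same _ _ _).1 h)
  case psi_y_succ_ne a x h => exact Rel.psi_y_succ_ne _ _ (by rwa [← f.same])
  case y_succ_psi_same a x h => exact Rel.y_succ_psi_same _ _ ((f.same _ _ _).1 h)
  case y_succ_psi_ne a x h => exact Rel.y_succ_psi_ne _ _ (by rwa [← f.same])
  case psi_sq_same a x h => exact Rel.psi_sq_same _ _ ((f.same _ _ _).1 h)
  case psi_sq_noEdge a x h₁ h₂ =>
    exact Rel.psi_sq_noEdge _ _ (by rwa [← f.same])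
      (by simpa only [StrandData.noEdge, f.edge] using h₂)
  case psi_sq_right a x h =>
    exact Rel.psi_sq_right _ _ (by simpa only [StrandData.arrow, f.edge] using h)
  case psi_sq_left a x h =>
    exact Rel.psi_sq_left _ _ (by simpa only [StrandData.arrow, f.edge] using h)
  case psi_sq_both a x h =>
    exact Rel.psi_sq_both _ _ (by simpa only [StrandData.darrow, f.edge] using h)
  case braid_right a b hb x h₁ h₂ =>
    exact Rel.braid_right _ _ hb _ ((f.same _ _ _).1 h₁)
      (by simpa only [StrandData.arrow, f.edge] using h₂)
  case braid_left a b hb x h₁ h₂ =>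
    exact Rel.braid_left _ _ hb _ ((f.same _ _ _).1 h₁)
      (by simpa only [StrandData.arrow, f.edge] using h₂)
  case braid_both a b hb x h₁ h₂ =>
    exact Rel.braid_both _ _ hb _ ((f.same _ _ _).1 h₁)
      (by simpa only [StrandData.darrow, f.edge] using h₂)
  case braid_otherwise a b hb x h =>
    exact Rel.braid_otherwise _ _ hb _
      (by simpa only [StrandData.noEdge, f.edge, f.same] using h)

/-- The algebra homomorphism with `e(x) ↦ e(f x)`, `y_a ↦ y_a`, `ψ_a ↦ ψ_a`. -/
def Pres.map {X' : Type u} [Fintype X] [Fintype X'] {D : StrandData n X}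
    {D' : StrandData n X'} (f : StrandIso D D') : Pres F D →ₐ[F] Pres F D' :=
  RingQuot.liftAlgHom F
    ⟨(RingQuot.mkAlgHom F (Rel F D')).comp
        (FreeAlgebra.lift F (fun g => FreeAlgebra.ι F (g.map f.toEquiv))),
      fun _ _ h => RingQuot.mkAlgHom_rel F (h.map f)⟩

theorem Pres.map_gen {X' : Type u} [Fintype X] [Fintype X'] {D : StrandData n X}
    {D' : StrandData n X'} (f : StrandIso D D') (g : Gen n X) :
    Pres.map (F := F) f (Pres.gen F D g) = Pres.gen F D' (g.map f.toEquiv) := by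
  refine (RingQuot.liftAlgHom_mkAlgHom_apply F _ _ _).trans ?_
  simp [Pres.gen]

end Presentation

/-! ### Quivers and tuples of vertices -/

section Tuples

variable {K : Type u} {n : ℕ}

/-- The tuple `k` has, for every vertex `x`, exactly `β x` components equal to `x`. -/
def HasContent (k : Fin (n + 1) → K) (β : K →₀ ℕ) : Prop :=
  ∀ x, Nat.card {a // k a = x} = β x

theorem HasContent.comp_perm {k : Fin (n + 1) → K} {β : K →₀ ℕ} (h : HasContent k β)
    (τ : Equiv.Perm (Fin (n + 1))) : HasContent (k ∘ τ) β := fun x => by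
  rw [← h x]
  exact Nat.card_congr (τ.subtypeEquiv fun _ => Iff.rfl)

theorem hasContent_perm_comp {k : Fin (n + 1) → K} {β : K →₀ ℕ} (σ : Equiv.Perm K) :
    HasContent (σ ∘ k) (β.equivMapDomain σ) ↔ HasContent k β := by
  have key : ∀ x, Nat.card {a // (σ ∘ k) a = σ x} = Nat.card {a // k a = x} := fun x => by
    simp
  constructor
  · intro h x
    rw [← key, h]
    simp [Finsupp.equivMapDomain_apply]
  · intro h x
    obtain ⟨x, rfl⟩ := σ.surjective x
    rw [key, h]
    simp [Finsupp.equivMapDomain_apply]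

theorem equivMapDomain_mul (τ τ' : Equiv.Perm K) (α : K →₀ ℕ) :
    α.equivMapDomain (τ * τ') = (α.equivMapDomain τ').equivMapDomain τ :=
  Finsupp.equivMapDomain_trans τ' τ α

variable (n) in
/-- The set `K^β` of tuples of length `n + 1` with content `β`. -/
def Tup (β : K →₀ ℕ) : Type u := {k : Fin (n + 1) → K // HasContent k β}

theorem finite_hasContent (β : K →₀ ℕ) : {k : Fin (n + 1) → K | HasContent k β}.Finite := by
  refine (Set.Finite.pi (fun _ : Fin (n + 1) => β.support.finite_toSet)).subset ?_
  intro k hk a _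
  have : Nonempty {b // k b = k a} := ⟨⟨a, rfl⟩⟩
  have := Nat.card_pos (α := {b // k b = k a})
  rw [hk] at this
  simpa using this.ne'

instance (β : K →₀ ℕ) : Finite (Tup n β) := (finite_hasContent (n := n) β).to_subtype

instance (β : K →₀ ℕ) : Fintype (Tup n β) := Fintype.ofFinite _

/-- `K^β` as index set of idempotents: `s_a · k` exchanges the components `a` and `a + 1`. -/
def tupData (Γ : Digraph K) (β : K →₀ ℕ) : StrandData n (Tup n β) where
  swap a k := ⟨k.1 ∘ Equiv.swap a.castSucc a.succ, k.2.comp_perm _⟩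
  same a b k := k.1 a = k.1 b
  edge a b k := Γ.Adj (k.1 a) (k.1 b)

end Tuples

/-! ### Quiver Hecke algebras and their cyclotomic quotients -/

section Algebras

variable {K : Type u} (F : Type v) [Field F] (n : ℕ) (Γ : Digraph K)

/-- The quiver Hecke algebra `R_β(Γ)` on `n + 1` strands. -/
abbrev QHA (β : K →₀ ℕ) : Type _ := Pres F (tupData (n := n) Γ β)

/-- The relations `y_1 ^ Λ_{k_1} e(k) = 0` in `R_β(Γ)`, for `k ∈ K^β`. -/
def cycloRel (Λ β : K →₀ ℕ) (l r : QHA F n Γ β) : Prop :=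
  ∃ k : Tup n β, l = Pres.gen F _ (.y 0) ^ Λ (k.1 0) * Pres.gen F _ (.e k) ∧ r = 0

/-- The cyclotomic quiver Hecke algebra `R_β^Λ(Γ)`: the quotient of `R_β(Γ)` by the two-sided ideal
generated by the `y_1 ^ Λ_{k_1} e(k)`. -/
abbrev CycloQHA (Λ β : K →₀ ℕ) : Type _ := RingQuot (cycloRel F n Γ Λ β)

end Algebras

/-! ### The automorphism of the quiver -/

/-- An automorphism `σ` of the quiver `Γ` all of whose orbits on the vertices have exactly `p`
elements: `σ^m(k) ≠ k = σ^p(k)` for all vertices `k` and all `0 < m < p`. -/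
structure QuiverAut {K : Type u} (Γ : Digraph K) (p : ℕ) where
  perm : Equiv.Perm K
  map_adj : ∀ k k', Γ.Adj k k' → Γ.Adj (perm k) (perm k')
  pow_apply : ∀ k, (perm ^ p) k = k
  pow_apply_ne : ∀ m, 0 < m → m < p → ∀ k, (perm ^ m) k ≠ k

section Sigma

variable {K : Type u} {Γ : Digraph K} {p : ℕ} (σ : QuiverAut Γ p)

theorem QuiverAut.pow_eq_one : σ.perm ^ p = 1 := Equiv.ext σ.pow_apply

theorem QuiverAut.map_adj_pow (m : ℕ) (k k' : K) (h : Γ.Adj k k') :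
    Γ.Adj ((σ.perm ^ m) k) ((σ.perm ^ m) k') := by
  induction m with
  | zero => simpa using h
  | succ m ih => simpa only [pow_succ', Equiv.Perm.mul_apply] using σ.map_adj _ _ ih

/-- The orbit `[α]` of `α` under `⟨σ⟩`, where `(σ · α)_k = α_{σ⁻¹(k)}`. -/
def Orb (α : K →₀ ℕ) : Set (K →₀ ℕ) := {β | ∃ m : ℤ, β = α.equivMapDomain (σ.perm ^ m)}

theorem Orb.map_mem {α β : K →₀ ℕ} (h : β ∈ Orb σ α) : β.equivMapDomain σ.perm ∈ Orb σ α := by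
  obtain ⟨m, rfl⟩ := h
  exact ⟨1 + m, by rw [zpow_add, equivMapDomain_mul, zpow_one]⟩

theorem Orb.map_symm_mem {α β : K →₀ ℕ} (h : β ∈ Orb σ α) :
    β.equivMapDomain σ.perm.symm ∈ Orb σ α := by
  obtain ⟨m, rfl⟩ := h
  exact ⟨-1 + m, by rw [zpow_add, equivMapDomain_mul, zpow_neg_one]; rfl⟩

variable [NeZero p]

theorem QuiverAut.adj_iff (k k' : K) : Γ.Adj (σ.perm k) (σ.perm k') ↔ Γ.Adj k k' := by
  refine ⟨fun h => ?_, σ.map_adj k k'⟩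
  have := σ.map_adj_pow (p - 1) _ _ h
  rwa [← Equiv.Perm.mul_apply, ← Equiv.Perm.mul_apply, pow_sub_one_mul (NeZero.ne p),
    σ.pow_eq_one] at this

theorem Orb.finite (α : K →₀ ℕ) : (Orb σ α).Finite := by
  refine ((Finset.range p).finite_toSet.image
    (fun m => α.equivMapDomain (σ.perm ^ m))).subset ?_
  rintro _ ⟨m, rfl⟩
  have hp : (p : ℤ) ≠ 0 := by exact_mod_cast NeZero.ne p
  refine ⟨(m % p).toNat, ?_, ?_⟩
  · have := Int.emod_lt_of_pos m (by omega : (0 : ℤ) < p)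
    simp only [Finset.coe_range, Set.mem_Iio]
    omega
  · have h0 := Int.emod_nonneg m hp
    have : σ.perm ^ m = σ.perm ^ (m % p).toNat := by
      rw [← zpow_natCast, Int.toNat_of_nonneg h0]
      conv_lhs => rw [← Int.emod_add_mul_ediv m p, zpow_add, zpow_mul, zpow_natCast,
        σ.pow_eq_one, one_zpow, mul_one]
    simp only [this]

/-- The bijection `K^β → K^(σ · β)`, `k ↦ (σ(k_1), …, σ(k_n))`, with its compatibilities. -/
def sigmaTup (n : ℕ) (β β' : K →₀ ℕ) (h : β' = β.equivMapDomain σ.perm) :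
    StrandIso (tupData (n := n) Γ β) (tupData (n := n) Γ β') where
  toEquiv := (Equiv.arrowCongr (Equiv.refl (Fin (n + 1))) σ.perm).subtypeEquiv fun k => by
    subst h; exact (hasContent_perm_comp σ.perm).symm
  swap _ _ := rfl
  same _ _ _ := (Equiv.apply_eq_iff_eq σ.perm).symm
  edge _ _ _ := (σ.adj_iff _ _).symm

variable (F : Type v) [Field F] (n : ℕ)

/-- The homomorphism `σ : R_β(Γ) → R_(σ · β)(Γ)` with `e(k) ↦ e(σ(k))`, `y_a ↦ y_a`,
`ψ_a ↦ ψ_a`. -/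
def sigmaHom (β β' : K →₀ ℕ) (h : β' = β.equivMapDomain σ.perm) :
    QHA F n Γ β →ₐ[F] QHA F n Γ β' := Pres.map (sigmaTup σ n β β' h)

/-- For a `σ`-stable weight `Λ`, the homomorphism `R_β^Λ(Γ) → R_(σ · β)^Λ(Γ)` induced by `σ`. -/
def sigmaCycloHom (Λ : K →₀ ℕ) (hΛ : ∀ k, Λ k = Λ (σ.perm k)) (β β' : K →₀ ℕ)
    (h : β' = β.equivMapDomain σ.perm) :
    CycloQHA F n Γ Λ β →ₐ[F] CycloQHA F n Γ Λ β' :=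
  RingQuot.liftAlgHom F
    ⟨(RingQuot.mkAlgHom F (cycloRel F n Γ Λ β')).comp (sigmaHom σ F n β β' h), by
      rintro _ _ ⟨k, rfl, rfl⟩
      rw [map_zero, ← map_zero (RingQuot.mkAlgHom F (cycloRel F n Γ Λ β'))]
      refine RingQuot.mkAlgHom_rel F ⟨(sigmaTup σ n β β' h).toEquiv k, ?_, rfl⟩
      have : Λ (((sigmaTup σ n β β' h).toEquiv k).1 0) = Λ (k.1 0) := (hΛ _).symm
      rw [this]
      simp only [RingHom.coe_coe, map_mul, map_pow, sigmaHom,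
        Pres.map_gen, Gen.map]⟩

/-! ### The algebras attached to an orbit `[α]`

The direct sum over the finite set `[α]` of unital algebras is their product. -/

/-- `R_[α](Γ) = ⊕_{β ∈ [α]} R_β(Γ)`. -/
abbrev QHAOrb (α : K →₀ ℕ) : Type _ := (β : Orb σ α) → QHA F n Γ β.1

/-- `R_[α]^Λ(Γ) = ⊕_{β ∈ [α]} R_β^Λ(Γ)`. -/
abbrev CycloQHAOrb (Λ α : K →₀ ℕ) : Type _ := (β : Orb σ α) → CycloQHA F n Γ Λ β.1

variable (α : K →₀ ℕ)

/-- The element `σ⁻¹ · β` of the orbit `[α]`. -/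
def Orb.pred (β : Orb σ α) : Orb σ α := ⟨β.1.equivMapDomain σ.perm.symm, Orb.map_symm_mem σ β.2⟩

theorem Orb.pred_spec (β : Orb σ α) :
    β.1 = (Orb.pred σ α β).1.equivMapDomain σ.perm := by
  ext k
  simp [Orb.pred, Finsupp.equivMapDomain_apply]

/-- The automorphism `σ` of `R_[α](Γ)`: it sends the summand `R_β(Γ)` to the summand
`R_(σ · β)(Γ)`. -/
def sigmaOrb : QHAOrb σ F n α →ₐ[F] QHAOrb σ F n α :=
  AlgHom.pi fun β =>
    (sigmaHom σ F n (Orb.pred σ α β).1 β.1 (Orb.pred_spec σ α β)).comp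
      (Pi.evalAlgHom F (fun β : Orb σ α => QHA F n Γ β.1) (Orb.pred σ α β))

/-- The automorphism `σ^Λ` of `R_[α]^Λ(Γ)`, for a `σ`-stable weight `Λ`. -/
def sigmaCycloOrb (Λ : K →₀ ℕ) (hΛ : ∀ k, Λ k = Λ (σ.perm k)) :
    CycloQHAOrb σ F n Λ α →ₐ[F] CycloQHAOrb σ F n Λ α :=
  AlgHom.pi fun β =>
    (sigmaCycloHom σ F n Λ hΛ (Orb.pred σ α β).1 β.1 (Orb.pred_spec σ α β)).comp
      (Pi.evalAlgHom F (fun β : Orb σ α => CycloQHA F n Γ Λ β.1) (Orb.pred σ α β))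

/-- The canonical projection `π_[α] : R_[α](Γ) → R_[α]^Λ(Γ)`. -/
def projOrb (Λ : K →₀ ℕ) : QHAOrb σ F n α →ₐ[F] CycloQHAOrb σ F n Λ α :=
  AlgHom.pi fun β =>
    (RingQuot.mkAlgHom F (cycloRel F n Γ Λ β.1)).comp
      (Pi.evalAlgHom F (fun β : Orb σ α => QHA F n Γ β.1) β)

theorem sigmaCycloOrb_projOrb (Λ : K →₀ ℕ) (hΛ : ∀ k, Λ k = Λ (σ.perm k))
    (x : QHAOrb σ F n α) :
    sigmaCycloOrb σ F n α Λ hΛ (projOrb σ F n α Λ x) = projOrb σ F n α Λ (sigmaOrb σ F n α x) := by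
  funext β
  simp [sigmaCycloOrb, projOrb, sigmaOrb, sigmaCycloHom]

/-- The fixed point subalgebra `R_[α](Γ)^σ`. -/
def fixedAffine : Subalgebra F (QHAOrb σ F n α) :=
  AlgHom.equalizer (sigmaOrb σ F n α) (AlgHom.id F (QHAOrb σ F n α))

/-- The fixed point subalgebra `R_[α]^Λ(Γ)^σ`. -/
def fixedCyclo (Λ : K →₀ ℕ) (hΛ : ∀ k, Λ k = Λ (σ.perm k)) :
    Subalgebra F (CycloQHAOrb σ F n Λ α) :=
  AlgHom.equalizer (sigmaCycloOrb σ F n α Λ hΛ) (AlgHom.id F (CycloQHAOrb σ F n Λ α))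

/-! ### Classes of tuples modulo `σ` -/

/-- The set `K^[α]`, the union of the `K^β` for `β ∈ [α]`. -/
def OrbTup : Type u := {k : Fin (n + 1) → K // ∃ β ∈ Orb σ α, HasContent k β}

instance : Finite (OrbTup σ n α) := by
  have : {k : Fin (n + 1) → K | ∃ β ∈ Orb σ α, HasContent k β}.Finite := by
    have h : {k : Fin (n + 1) → K | ∃ β ∈ Orb σ α, HasContent k β}
        = ⋃ β ∈ Orb σ α, {k : Fin (n + 1) → K | HasContent k β} := by
      ext k; simp
    rw [h]
    exact (Orb.finite σ α).biUnion fun β _ => finite_hasContent β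
  exact this.to_subtype

instance : Fintype (OrbTup σ n α) := Fintype.ofFinite _

/-- The bijection of `K^[α]` induced by `σ`. -/
def OrbTup.sigma : Equiv.Perm (OrbTup σ n α) :=
  (Equiv.arrowCongr (Equiv.refl (Fin (n + 1))) σ.perm).subtypeEquiv fun k => by
    constructor
    · rintro ⟨β, hβ, hk⟩
      exact ⟨_, Orb.map_mem σ hβ, (hasContent_perm_comp σ.perm).2 hk⟩
    · rintro ⟨β, hβ, hk⟩
      refine ⟨_, Orb.map_symm_mem σ hβ, (hasContent_perm_comp σ.perm).1 ?_⟩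
      have hβ' : (β.equivMapDomain σ.perm.symm).equivMapDomain σ.perm = β :=
        (Orb.pred_spec σ α ⟨β, hβ⟩).symm
      rw [hβ']
      exact hk

/-- The quotient `K^[α]_σ` of `K^[α]` by the equivalence relation generated by `k ∼ σ(k)`. -/
def OrbClass : Type u := Quot (fun k l : OrbTup σ n α => l = OrbTup.sigma σ n α k)

/-- The class of a tuple. -/
def OrbClass.mk (k : OrbTup σ n α) : OrbClass σ n α := Quot.mk _ k

instance : Finite (OrbClass σ n α) := by
  unfold OrbClass; infer_instance

instance : Fintype (OrbClass σ n α) := Fintype.ofFinite _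

/-- `K^[α]_σ` as index set of idempotents: `s_a · γ`, `γ_a = γ_b` and "`(γ_a, γ_b)` is an edge" are
computed on any representative of the class `γ`. -/
def classData : StrandData n (OrbClass σ n α) where
  swap a := Quot.map
    (fun k => ⟨k.1 ∘ Equiv.swap a.castSucc a.succ,
      k.2.imp fun _ h => ⟨h.1, h.2.comp_perm _⟩⟩)
    (by rintro k _ rfl; rfl)
  same a b := Quot.lift (fun k => k.1 a = k.1 b)
    (by rintro k _ rfl; exact propext (Equiv.apply_eq_iff_eq σ.perm).symm)
  edge a b := Quot.lift (fun k => Γ.Adj (k.1 a) (k.1 b))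
    (by rintro k _ rfl; exact propext (σ.adj_iff _ _).symm)

/-- The integer `Λ_{γ_1}`, computed on any representative of the class `γ`. -/
def classLevel (Λ : K →₀ ℕ) (hΛ : ∀ k, Λ k = Λ (σ.perm k)) : OrbClass σ n α → ℕ :=
  Quot.lift (fun k => Λ (k.1 0)) (by rintro k _ rfl; exact hΛ _)

/-! ### The elements `e(k)`, `e(γ)`, `y_a`, `ψ_a` of `R_[α](Γ)` -/

open Classical in
/-- The idempotent `e(k)` of `R_[α](Γ)`, for `k ∈ K^[α]`: it lies in the summand `R_β(Γ)` with
`k ∈ K^β`. -/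
def eTup (k : OrbTup σ n α) : QHAOrb σ F n α := fun β =>
  if h : HasContent k.1 β.1 then Pres.gen F _ (.e ⟨k.1, h⟩) else 0

open Classical in
/-- The idempotent `e(γ)`, the sum of the `e(k)` for `k ∈ γ`. -/
def eClass (γ : OrbClass σ n α) : QHAOrb σ F n α :=
  ∑ k : OrbTup σ n α with OrbClass.mk σ n α k = γ, eTup σ F n α k

/-- The element `y_a` of `R_[α](Γ)`. -/
def yOrb (a : Fin (n + 1)) : QHAOrb σ F n α := fun _ => Pres.gen F _ (.y a)

/-- The element `ψ_a` of `R_[α](Γ)`. -/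
def psiOrb (a : Fin n) : QHAOrb σ F n α := fun _ => Pres.gen F _ (.psi a)

theorem sigmaOrb_yOrb (a : Fin (n + 1)) : sigmaOrb σ F n α (yOrb σ F n α a) = yOrb σ F n α a := by
  funext β
  simp [sigmaOrb, yOrb, sigmaHom, Pres.map_gen, Gen.map]

theorem sigmaOrb_psiOrb (a : Fin n) :
    sigmaOrb σ F n α (psiOrb σ F n α a) = psiOrb σ F n α a := by
  funext β
  simp [sigmaOrb, psiOrb, sigmaHom, Pres.map_gen, Gen.map]

theorem sigmaOrb_eTup (k : OrbTup σ n α) :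
    sigmaOrb σ F n α (eTup σ F n α k) = eTup σ F n α (OrbTup.sigma σ n α k) := by
  funext β
  have hiff : HasContent (OrbTup.sigma σ n α k).1 β.1 ↔ HasContent k.1 (Orb.pred σ α β).1 := by
    conv_lhs => rw [Orb.pred_spec σ α β]
    exact hasContent_perm_comp σ.perm
  simp only [sigmaOrb, eTup, AlgHom.pi_apply, AlgHom.comp_apply, Pi.evalAlgHom_apply]
  by_cases h : HasContent k.1 (Orb.pred σ α β).1
  · rw [dif_pos h, dif_pos (hiff.2 h), sigmaHom, Pres.map_gen]
    rfl
  · rw [dif_neg h, dif_neg (fun h' => h (hiff.1 h')), map_zero]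

theorem sigmaOrb_eClass (γ : OrbClass σ n α) :
    sigmaOrb σ F n α (eClass σ F n α γ) = eClass σ F n α γ := by
  classical
  have hmk : ∀ k, OrbClass.mk σ n α (OrbTup.sigma σ n α k) = OrbClass.mk σ n α k :=
    fun k => (Quot.sound (r := fun k l : OrbTup σ n α => l = OrbTup.sigma σ n α k) rfl).symm
  simp only [eClass, Finset.sum_filter, map_sum, apply_ite (sigmaOrb σ F n α), map_zero,
    sigmaOrb_eTup]
  refine Eq.trans ?_ (Equiv.sum_comp (OrbTup.sigma σ n α)
    (fun k => if OrbClass.mk σ n α k = γ then eTup σ F n α k else 0))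
  simp only [hmk]

/-- The element `e(γ)` of `R_[α](Γ)^σ`. -/
def eFix (γ : OrbClass σ n α) : fixedAffine σ F n α := ⟨eClass σ F n α γ, sigmaOrb_eClass σ F n α γ⟩

/-- The element `y_a` of `R_[α](Γ)^σ`. -/
def yFix (a : Fin (n + 1)) : fixedAffine σ F n α := ⟨yOrb σ F n α a, sigmaOrb_yOrb σ F n α a⟩

/-- The relations `y_1 ^ Λ_{γ_1} e(γ) = 0` in `R_[α](Γ)^σ`, for `γ ∈ K^[α]_σ`. -/
def cycloFixRel (Λ : K →₀ ℕ) (hΛ : ∀ k, Λ k = Λ (σ.perm k)) (l r : fixedAffine σ F n α) : Prop :=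
  ∃ γ : OrbClass σ n α, l = yFix σ F n α 0 ^ classLevel σ n α Λ hΛ γ * eFix σ F n α γ ∧ r = 0

/-- The algebra `(R_[α](Γ)^σ)^Λ`: the quotient of `R_[α](Γ)^σ` by the two-sided ideal generated by
the `y_1 ^ Λ_{γ_1} e(γ)`. -/
abbrev CycloOfFixed (Λ : K →₀ ℕ) (hΛ : ∀ k, Λ k = Λ (σ.perm k)) : Type _ :=
  RingQuot (cycloFixRel σ F n α Λ hΛ)

/-- The algebra with generators `e(γ)` for `γ ∈ K^[α]_σ`, `y_a` and `ψ_a`, subject to the quiver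
Hecke relations written for the classes `γ` and to `y_1 ^ Λ_{γ_1} e(γ) = 0`. -/
abbrev FixedPres (Λ : K →₀ ℕ) (hΛ : ∀ k, Λ k = Λ (σ.perm k)) : Type _ :=
  CycloPres F (classData σ n α) (classLevel σ n α Λ hΛ)

/-- A generator of the presented algebra `FixedPres`. -/
abbrev fixedPresGen (Λ : K →₀ ℕ) (hΛ : ∀ k, Λ k = Λ (σ.perm k)) (g : Gen n (OrbClass σ n α)) :
    FixedPres σ F n α Λ hΛ :=
  CycloPres.gen F (classData σ n α) (classLevel σ n α Λ hΛ) g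

end Sigma

end QuiverHecke

end

/-!
The presented algebra `B` (generators `e(γ)`, `y_a`, `ψ_a`, the quiver Hecke relations for classes
of tuples and the cyclotomic relations) maps to `(R_[α](Γ)^σ)^Λ`, which maps to `R_[α]^Λ(Γ)^σ`.
Both statements follow once the first map is surjective and the composite is bijective.

*Well-definedness.* Every relation has the form `l e(x) = r e(x)`, up to relations without
idempotents, and only depends on data that are constant on classes. It can therefore be summed over
the tuples of a class (`Satisfies.sum_fibre`).

*Surjectivity.* Let `A` be `R_[α](Γ)` or `R_[α]^Λ(Γ)`, and `S` the subalgebra generated by the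
`e(γ)`, `y_a`, `ψ_a`. Moving idempotents to the right in a word shows that for all `a ∈ A` and
`k ∈ K^[α]` there is `s ∈ S` with `a e(k) = s e(k)` (`exists_mul_idem_eq`). If `a` is fixed by `σ`,
applying `σ` gives `a e(k') = s e(k')` with the same `s` for all `k'` in the class `γ` of `k`, so
`a e(γ) = s e(γ)` and `a = ∑ a e(γ)` lies in `S` (`mem_of_fixed`). No averaging over `⟨σ⟩` takes
place.

*Injectivity.* For `β ∈ [α]` consider the direct sum over `k ∈ K^β` of the right ideals `e(γ) B`,
with `γ` the class of `k`. It is a representation of `R_β^Λ(Γ)` (`fibreModule`, `cycloRep`): `e(k)`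
projects to the component of `k`, `y_a` acts by left multiplication, and `ψ_a` acts by left
multiplication from the component of `k` to that of `s_a · k`. The sum of the components is a
`B`-linear map to `B`, where `b ∈ B` acts on the source through `R_β^Λ(Γ)`
(`sum_fibreGen_apply`). Hence if `b` maps to zero in all the `R_β^Λ(Γ)`, then `b e(γ) = 0` for all
classes `γ`, and `b = 0`.
-/

namespace QuiverHecke

universe u v w

/-! ### Compatible maps of index sets -/

section Covering

variable {n : ℕ} {X Y : Type u}

/-- A map of index sets compatible with the strand data. -/
structure StrandHom (D : StrandData n X) (D' : StrandData n Y) where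
  toFun : X → Y
  swap : ∀ a x, toFun (D.swap a x) = D'.swap a (toFun x)
  same : ∀ a b x, D.same a b x ↔ D'.same a b (toFun x)
  edge : ∀ a b x, D.edge a b x ↔ D'.edge a b (toFun x)

/-- The maps `swap a` satisfy the identities of the place permutations of tuples: they define an
action of the symmetric group, and exchanging equal components has no effect. -/
structure StrandData.IsPlaceAction (D : StrandData n X) : Prop where
  swap_swap : ∀ a x, D.swap a (D.swap a x) = x
  swap_of_same : ∀ a x, D.same a.castSucc a.succ x → D.swap a x = x
  swap_comm : ∀ a b : Fin n, a.val + 1 < b.val ∨ b.val + 1 < a.val → ∀ x,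
    D.swap a (D.swap b x) = D.swap b (D.swap a x)
  swap_braid : ∀ a b : Fin n, b.val = a.val + 1 → ∀ x,
    D.swap b (D.swap a (D.swap b x)) = D.swap a (D.swap b (D.swap a x))
  swap_braid_of_same : ∀ a b : Fin n, b.val = a.val + 1 → ∀ x, D.same b.succ a.castSucc x →
    D.swap a (D.swap b (D.swap a x)) = x

variable (F : Type v) [Field F] {R : Type w} [Ring R] [Algebra F R]

/-- The images `g` of the generators satisfy the quiver Hecke relations. -/
def Satisfies [Fintype X] (D : StrandData n X) (g : Gen n X → R) : Prop :=
  ∀ l r, Rel F D l r → FreeAlgebra.lift F g l = FreeAlgebra.lift F g r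

variable {F}

theorem satisfies_gen [Fintype X] (D : StrandData n X) : Satisfies F D (Pres.gen F D) :=
  fun l r h => by
    have key : FreeAlgebra.lift F (Pres.gen F D) = RingQuot.mkAlgHom F (Rel F D) := by
      ext; simp [Pres.gen]
    rw [key]
    exact RingQuot.mkAlgHom_rel F h

open Classical in
/-- The images of the generators indexed by `Y` deduced from those indexed by `X` along a map
`q : X → Y`: the idempotent of `y` is the sum of the idempotents of the fibre of `y`. -/
noncomputable def sumFibre {M : Type*} [AddCommMonoid M] [Fintype X] (q : X → Y) (g : Gen n X → M) :
    Gen n Y → M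
  | .e y => ∑ x with q x = y, g (.e x)
  | .y a => g (.y a)
  | .psi a => g (.psi a)

theorem map_sumFibre {M M' : Type*} [AddCommMonoid M] [AddCommMonoid M'] [Fintype X] (q : X → Y)
    (g : Gen n X → M) (φ : M →+ M') (x : Gen n Y) :
    φ (sumFibre q g x) = sumFibre q (φ ∘ g) x := by
  cases x <;> simp [sumFibre]

variable [Fintype Y] {D : StrandData n X} {D' : StrandData n Y}

section

variable [Fintype X]

/-- Along a compatible map of index sets, the sums over the fibres satisfy the relations again:
each relation has the form `l e(x) = r e(x)` and can be summed over a fibre. -/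
theorem Satisfies.sum_fibre (q : StrandHom D D') (hX : ∀ a x, D.swap a (D.swap a x) = x)
    (hY : ∀ a y, D'.swap a (D'.swap a y) = y) {g : Gen n X → R} (hg : Satisfies F D g) :
    Satisfies F D' (sumFibre q.toFun g) := by
  classical
  have hee : ∀ x x', g (.e x) * g (.e x') = if x = x' then g (.e x) else 0 := fun x x' => by
    split_ifs with h
    · subst h
      simpa using hg _ _ (Rel.e_idem x)
    · simpa using hg _ _ (Rel.e_orth x x' h)
  intro l r h
  cases h <;> simp only [map_sum, map_mul, map_one, map_zero, map_add, map_sub, map_pow, map_ofNat,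
    FreeAlgebra.lift_ι_apply, sumFibre, Finset.mul_sum]
  case sum_e =>
    refine (Finset.sum_fiberwise Finset.univ q.toFun fun x => g (.e x)).trans ?_
    simpa using hg _ _ Rel.sum_e
  case e_idem y =>
    simp only [Finset.sum_mul, hee]
    refine Finset.sum_congr rfl fun x hx => ?_
    rw [Finset.sum_ite_eq', if_pos hx]
  case e_orth y y' h =>
    refine Finset.sum_eq_zero fun x hx => ?_
    rw [Finset.sum_mul]
    refine Finset.sum_eq_zero fun x' hx' => ?_
    rw [hee, if_neg]
    rintro rfl
    simp only [Finset.mem_filter, Finset.mem_univ, true_and] at hx hx'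
    exact h (hx'.symm.trans hx)
  case y_e a y =>
    rw [Finset.sum_mul]
    exact Finset.sum_congr rfl fun x _ => by simpa using hg _ _ (Rel.y_e a x)
  case psi_e a y =>
    rw [Finset.sum_mul]
    refine Finset.sum_bij' (fun x _ => D.swap a x) (fun x _ => D.swap a x) ?_ ?_
      (fun x _ => hX a x) (fun x _ => hX a x) fun x _ => by simpa using hg _ _ (Rel.psi_e a x)
    · intro x hx
      simp only [Finset.mem_filter, Finset.mem_univ, true_and] at hx ⊢
      rw [q.swap, hx]
    · intro x hx
      simp only [Finset.mem_filter, Finset.mem_univ, true_and] at hx ⊢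
      rw [q.swap, hx, hY]
  case y_y a b => simpa using hg _ _ (Rel.y_y a b)
  case psi_y a b h₁ h₂ => simpa using hg _ _ (Rel.psi_y a b h₁ h₂)
  case psi_psi a b h => simpa using hg _ _ (Rel.psi_psi a b h)
  case psi_sq_same a y h =>
    refine Finset.sum_eq_zero fun x hx => ?_
    obtain rfl := (Finset.mem_filter.1 hx).2
    simpa using hg _ _ (Rel.psi_sq_same a x ((q.same _ _ _).2 h))
  all_goals
    refine Finset.sum_congr rfl fun x hx => ?_
    obtain rfl := (Finset.mem_filter.1 hx).2
  case psi_y_succ_same a h =>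
    simpa using hg _ _ (Rel.psi_y_succ_same a x ((q.same _ _ _).2 h))
  case psi_y_succ_ne a h =>
    simpa using hg _ _ (Rel.psi_y_succ_ne a x (by rwa [q.same]))
  case y_succ_psi_same a h =>
    simpa using hg _ _ (Rel.y_succ_psi_same a x ((q.same _ _ _).2 h))
  case y_succ_psi_ne a h =>
    simpa using hg _ _ (Rel.y_succ_psi_ne a x (by rwa [q.same]))
  case psi_sq_noEdge a h₁ h₂ =>
    simpa using hg _ _ (Rel.psi_sq_noEdge a x (by rwa [q.same])
      (by simpa only [StrandData.noEdge, q.edge] using h₂))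
  case psi_sq_right a h =>
    simpa using hg _ _ (Rel.psi_sq_right a x (by simpa only [StrandData.arrow, q.edge] using h))
  case psi_sq_left a h =>
    simpa using hg _ _ (Rel.psi_sq_left a x (by simpa only [StrandData.arrow, q.edge] using h))
  case psi_sq_both a h =>
    simpa using hg _ _ (Rel.psi_sq_both a x (by simpa only [StrandData.darrow, q.edge] using h))
  case braid_right a b hb h₁ h₂ =>
    simpa using hg _ _ (Rel.braid_right a b hb x ((q.same _ _ _).2 h₁)
      (by simpa only [StrandData.arrow, q.edge] using h₂))
  case braid_left a b hb h₁ h₂ =>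
    simpa using hg _ _ (Rel.braid_left a b hb x ((q.same _ _ _).2 h₁)
      (by simpa only [StrandData.arrow, q.edge] using h₂))
  case braid_both a b hb h₁ h₂ =>
    simpa [map_ofNat] using hg _ _ (Rel.braid_both a b hb x ((q.same _ _ _).2 h₁)
      (by simpa only [StrandData.darrow, q.edge] using h₂))
  case braid_otherwise a b hb h =>
    simpa using hg _ _ (Rel.braid_otherwise a b hb x
      (by simpa only [StrandData.noEdge, q.edge, q.same] using h))

end

/-! ### The representation induced along a map of index sets -/

variable (F) in
/-- For images `g` in `R` of generators indexed by `Y` and a map `q : X → Y`, the direct sum over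
`x ∈ X` of the right ideals `e(q x) R`, realised as the functions `f : X → R` with
`f x ∈ e(q x) R`. -/
def fibreModule (q : X → Y) (g : Gen n Y → R) : Submodule F (X → R) where
  carrier := {f | ∀ x, g (.e (q x)) * f x = f x}
  add_mem' hf hf' x := by simp only [Pi.add_apply, mul_add, hf x, hf' x]
  zero_mem' x := by simp
  smul_mem' c f hf x := by simp only [Pi.smul_apply, mul_smul_comm, hf x]

open Classical in
/-- The action of the generators indexed by `X` on `fibreModule`: `e(x)` is the projection to the
component `x`, `y_a` preserves each component, and `ψ_a` sends the component `x` to the component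
`s_a · x`. -/
noncomputable def fibreGen (q : StrandHom D D') (hX : ∀ a x, D.swap a (D.swap a x) = x)
    {g : Gen n Y → R} (hg : Satisfies F D' g) :
    Gen n X → Module.End F (fibreModule F q.toFun g)
  | .e x =>
    { toFun := fun f => ⟨Pi.single x (f.1 x), fun k => by
        by_cases h : k = x
        · subst h; simpa using f.2 k
        · simp [h]⟩
      map_add' := fun f f' => Subtype.ext (by simp [Pi.single_add])
      map_smul' := fun c f => Subtype.ext (by simp [Pi.single_smul]) }
  | .y a =>
    { toFun := fun f => ⟨fun k => g (.y a) * f.1 k, fun k => by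
        have h := hg _ _ (Rel.y_e a (q.toFun k))
        simp only [map_mul, FreeAlgebra.lift_ι_apply] at h
        rw [← mul_assoc, ← h, mul_assoc, f.2 k]⟩
      map_add' := fun f f' => Subtype.ext (by ext; simp [mul_add])
      map_smul' := fun c f => Subtype.ext (by ext; simp) }
  | .psi a =>
    { toFun := fun f => ⟨fun k => g (.psi a) * f.1 (D.swap a k), fun k => by
        have h := hg _ _ (Rel.psi_e a (q.toFun (D.swap a k)))
        simp only [map_mul, FreeAlgebra.lift_ι_apply] at h
        rw [← q.swap, hX] at h
        rw [← mul_assoc, ← h, mul_assoc, f.2 (D.swap a k)]⟩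
      map_add' := fun f f' => Subtype.ext (by ext; simp [mul_add])
      map_smul' := fun c f => Subtype.ext (by ext; simp) }

section
variable (q : StrandHom D D') (hX : ∀ a x, D.swap a (D.swap a x) = x)
  {g : Gen n Y → R} (hg : Satisfies F D' g) (f : fibreModule F q.toFun g)

theorem coe_fibreGen_e [DecidableEq X] (x : X) :
    (fibreGen q hX hg (.e x) f : X → R) = Pi.single x (f.1 x) := by
  simp only [fibreGen, LinearMap.coe_mk, AddHom.coe_mk]
  congr!

theorem coe_fibreGen_y (a : Fin (n + 1)) :
    (fibreGen q hX hg (.y a) f : X → R) = g (.y a) • f.1 := rfl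

theorem coe_fibreGen_psi (a : Fin n) :
    (fibreGen q hX hg (.psi a) f : X → R) = g (.psi a) • (f.1 ∘ D.swap a) := rfl

end

theorem smul_single_comp_swap [DecidableEq X] (hX : ∀ a x, D.swap a (D.swap a x) = x) (a : Fin n)
    (x : X) (r v : R) :
    r • ((Pi.single x v : X → R) ∘ D.swap a) = Pi.single (D.swap a x) (r * v) := by
  funext k
  by_cases h : k = D.swap a x
  · subst h; simp [hX]
  · have : D.swap a k ≠ x := fun h' => h (by rw [← h', hX])
    simp [h, this]

theorem smul_single_eq [DecidableEq X] (x : X) (r v : R) :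
    r • (Pi.single x v : X → R) = Pi.single x (r * v) := by
  rw [← Pi.single_smul, smul_eq_mul]

variable [Fintype X]

/-- The operators `fibreGen` satisfy the quiver Hecke relations: on the component `x` the two sides of
a relation act through the relation of `R` for `q x`, and by the identities of `IsPlaceAction` all
their terms end in the same component. -/
theorem satisfies_fibreGen (q : StrandHom D D') (hD : D.IsPlaceAction)
    {g : Gen n Y → R} (hg : Satisfies F D' g) :
    Satisfies F D (fibreGen q hD.swap_swap hg) := by
  classical
  intro l r h
  ext f : 1
  apply Subtype.ext
  -- A relation of `R` of the form `l e(q x) = r e(q x)` can be applied to `f x ∈ e(q x) R`.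
  have key : ∀ (x : X) (l r : R), l * g (.e (q.toFun x)) = r * g (.e (q.toFun x)) →
      l * f.1 x = r * f.1 x := fun x l r h => by
    rw [← f.2 x, ← mul_assoc, h, mul_assoc]
  cases h <;> simp only [map_sum, map_mul, map_one, map_zero, map_add, map_sub,
    FreeAlgebra.lift_ι_apply, Module.End.mul_apply, LinearMap.add_apply, LinearMap.sub_apply,
    LinearMap.zero_apply, Module.End.one_apply, pow_two, LinearMap.sum_apply,
    Submodule.coe_sum, two_mul,
    coe_fibreGen_e, coe_fibreGen_y, coe_fibreGen_psi, Submodule.coe_add, Submodule.coe_sub,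
    Submodule.coe_zero, smul_single_comp_swap hD.swap_swap, smul_single_eq, hD.swap_swap]
  case sum_e => exact Finset.univ_sum_single f.1
  case e_idem x => rw [Pi.single_eq_same]
  case e_orth x x' h => rw [Pi.single_eq_of_ne h, Pi.single_zero]
  case y_e a x => rfl
  case psi_e a x => simp [hD.swap_swap]
  case y_y a b =>
    have h := hg _ _ (Rel.y_y a b)
    simp only [map_mul, FreeAlgebra.lift_ι_apply] at h
    rw [smul_smul, smul_smul, h]
  case psi_y a b h₁ h₂ =>
    have h := hg _ _ (Rel.psi_y a b h₁ h₂)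
    simp only [map_mul, FreeAlgebra.lift_ι_apply] at h
    funext k
    simp only [Pi.smul_apply, Function.comp_apply, smul_eq_mul, ← mul_assoc, h]
  case psi_psi a b h =>
    have h' := hg _ _ (Rel.psi_psi a b h)
    simp only [map_mul, FreeAlgebra.lift_ι_apply] at h'
    funext k
    simp only [Pi.smul_apply, Function.comp_apply, smul_eq_mul, ← mul_assoc, h',
      hD.swap_comm a b h k]
  case psi_y_succ_same a x h =>
    rw [hD.swap_of_same a x h, ← Pi.single_add, ← mul_assoc, ← mul_assoc, ← add_one_mul]
    exact congrArg _ (key x _ _ (by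
      simpa using hg _ _ (Rel.psi_y_succ_same a _ ((q.same _ _ _).1 h))))
  case psi_y_succ_ne a x h =>
    rw [← mul_assoc, ← mul_assoc]
    exact congrArg _ (key x _ _ (by
      simpa using hg _ _ (Rel.psi_y_succ_ne a _ (by rwa [← q.same]))))
  case y_succ_psi_same a x h =>
    rw [hD.swap_of_same a x h, ← Pi.single_add, ← mul_assoc, ← mul_assoc, ← add_one_mul]
    exact congrArg _ (key x _ _ (by
      simpa using hg _ _ (Rel.y_succ_psi_same a _ ((q.same _ _ _).1 h))))
  case y_succ_psi_ne a x h =>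
    rw [← mul_assoc, ← mul_assoc]
    exact congrArg _ (key x _ _ (by
      simpa using hg _ _ (Rel.y_succ_psi_ne a _ (by rwa [← q.same]))))
  case psi_sq_same a x h =>
    rw [← mul_assoc, key x _ 0 (by
      simpa [pow_two] using hg _ _ (Rel.psi_sq_same a _ ((q.same _ _ _).1 h))),
      zero_mul, Pi.single_zero]
  case psi_sq_noEdge a x h₁ h₂ =>
    rw [← mul_assoc, key x _ 1 (by
      simpa [pow_two] using hg _ _ (Rel.psi_sq_noEdge a (q.toFun x) (by rwa [← q.same])
        (by simpa only [StrandData.noEdge, q.edge] using h₂))), one_mul]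
  case psi_sq_right a x h =>
    rw [← Pi.single_sub, ← mul_assoc, ← sub_mul]
    exact congrArg _ (key x _ _ (by
      simpa [pow_two] using hg _ _ (Rel.psi_sq_right a (q.toFun x)
        (by simpa only [StrandData.arrow, q.edge] using h))))
  case psi_sq_left a x h =>
    rw [← Pi.single_sub, ← mul_assoc, ← sub_mul]
    exact congrArg _ (key x _ _ (by
      simpa [pow_two] using hg _ _ (Rel.psi_sq_left a (q.toFun x)
        (by simpa only [StrandData.arrow, q.edge] using h))))
  case psi_sq_both a x h =>
    simp only [← Pi.single_sub, ← mul_sub, ← mul_assoc, ← sub_mul]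
    exact congrArg _ (key x _ _ (by
      simpa [pow_two] using hg _ _ (Rel.psi_sq_both a (q.toFun x)
        (by simpa only [StrandData.darrow, q.edge] using h))))
  case braid_right a b hb x h₁ h₂ =>
    rw [hD.swap_braid a b hb, hD.swap_braid_of_same a b hb x h₁]
    simp only [← Pi.single_sub, ← mul_assoc, ← sub_one_mul]
    exact congrArg _ (key x _ _ (by
      simpa using hg _ _ (Rel.braid_right a b hb (q.toFun x) ((q.same _ _ _).1 h₁)
        (by simpa only [StrandData.arrow, q.edge] using h₂))))
  case braid_left a b hb x h₁ h₂ =>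
    rw [hD.swap_braid a b hb, hD.swap_braid_of_same a b hb x h₁]
    simp only [← Pi.single_add, ← mul_assoc, ← add_one_mul]
    exact congrArg _ (key x _ _ (by
      simpa using hg _ _ (Rel.braid_left a b hb (q.toFun x) ((q.same _ _ _).1 h₁)
        (by simpa only [StrandData.arrow, q.edge] using h₂))))
  case braid_both a b hb x h₁ h₂ =>
    rw [hD.swap_braid a b hb, hD.swap_braid_of_same a b hb x h₁]
    simp only [← Pi.single_sub, ← Pi.single_add, ← mul_assoc, ← sub_mul, ← add_mul]
    exact congrArg _ (key x _ _ (by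
      simpa [map_ofNat, two_mul] using hg _ _ (Rel.braid_both a b hb (q.toFun x)
        ((q.same _ _ _).1 h₁) (by simpa only [StrandData.darrow, q.edge] using h₂))))
  case braid_otherwise a b hb x h =>
    rw [hD.swap_braid a b hb]
    simp only [← mul_assoc]
    exact congrArg _ (key x _ _ (by
      simpa using hg _ _ (Rel.braid_otherwise a b hb (q.toFun x)
        (by simpa only [StrandData.noEdge, q.edge, q.same] using h))))

/-- Summation of the components intertwines the action of a word through the sums over the
fibres with left multiplication by that word in `R`. -/
theorem sum_fibreGen_apply (q : StrandHom D D') (hX : ∀ a x, D.swap a (D.swap a x) = x)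
    {g : Gen n Y → R} (hg : Satisfies F D' g) (w : FreeAlgebra F (Gen n Y))
    (f : fibreModule F q.toFun g) :
    ∑ x, (FreeAlgebra.lift F (sumFibre q.toFun (fibreGen q hX hg)) w f).1 x =
      FreeAlgebra.lift F g w * ∑ x, f.1 x := by
  classical
  induction w using FreeAlgebra.induction generalizing f with
  | grade0 r =>
    simp [Algebra.smul_def, Finset.mul_sum, Module.algebraMap_end_apply]
  | grade1 x =>
    simp only [FreeAlgebra.lift_ι_apply]
    cases x with
    | e y =>
      have hR : ∀ x, g (.e y) * f.1 x = if q.toFun x = y then f.1 x else 0 := fun x => by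
        split_ifs with h
        · subst h
          exact f.2 x
        · have := hg _ _ (Rel.e_orth y (q.toFun x) (Ne.symm h))
          simp only [map_mul, FreeAlgebra.lift_ι_apply, map_zero] at this
          rw [← f.2 x, ← mul_assoc, this, zero_mul]
      simp only [sumFibre, LinearMap.sum_apply, Submodule.coe_sum, coe_fibreGen_e,
        Finset.sum_apply, Finset.mul_sum, hR]
      rw [Finset.sum_comm, Finset.sum_filter]
      simp
    | y a => simp [sumFibre, coe_fibreGen_y, Finset.mul_sum]
    | psi a =>
      simp only [sumFibre, coe_fibreGen_psi, Pi.smul_apply, Function.comp_apply, smul_eq_mul,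
        ← Finset.mul_sum]
      congr 1
      exact Equiv.sum_comp (Function.Involutive.toPerm (D.swap a) (hX a)) f.1
  | mul a b ha hb => rw [map_mul, map_mul, Module.End.mul_apply, ha, hb, mul_assoc]
  | add a b ha hb =>
    simp only [map_add, LinearMap.add_apply, Submodule.coe_add, Pi.add_apply,
      Finset.sum_add_distrib, ha, hb, add_mul]

/-- A word whose image in the representation `fibreModule` vanishes kills the idempotents `e(q x)`
in `R`. -/
theorem lift_mul_eq_zero_of_fibreGen (q : StrandHom D D')
    (hX : ∀ a x, D.swap a (D.swap a x) = x) {g : Gen n Y → R} (hg : Satisfies F D' g)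
    {w : FreeAlgebra F (Gen n Y)}
    (hw : FreeAlgebra.lift F (sumFibre q.toFun (fibreGen q hX hg)) w = 0) (x : X) :
    FreeAlgebra.lift F g w * g (.e (q.toFun x)) = 0 := by
  classical
  have he := hg _ _ (Rel.e_idem (q.toFun x))
  simp only [map_mul, FreeAlgebra.lift_ι_apply] at he
  have h := sum_fibreGen_apply q hX hg w ⟨Pi.single x (g (.e (q.toFun x))), fun k => by
    by_cases hk : k = x
    · subst hk; simpa using he
    · simp [hk]⟩
  rw [hw] at h
  simpa using h.symm

end Covering

/-! ### Fixed points of an automorphism permuting the idempotents -/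

/-- Let `A` be generated by orthogonal idempotents `e x` of sum `1` and elements `g i` such that
each `g i e(x)` equals some `e(x') g i`. If a subalgebra `S` contains the `g i`, then `A e(x)` is
contained in `S e(x)`. It suffices to treat the blocks `e(x') a e(x)`, and the property is
multiplicative in `a` because `1 = ∑ e(z)` can be inserted between two factors. -/
theorem exists_mul_idem_eq {F A X I : Type*} [Field F] [Ring A] [Algebra F A] [Fintype X]
    {e : X → A} (he : OrthogonalIdempotents e) (hsum : ∑ x, e x = 1) {g : I → A}
    (hg : ∀ i x, ∃ x', g i * e x = e x' * g i)
    (hgen : Algebra.adjoin F (Set.range e ∪ Set.range g) = ⊤)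
    (S : Subalgebra F A) (hS : ∀ i, g i ∈ S) (a : A) (x : X) :
    ∃ s ∈ S, a * e x = s * e x := by
  classical
  have key : ∀ x x', ∃ s ∈ S, e x' * a * e x = s * e x := by
    have ha : a ∈ Algebra.adjoin F (Set.range e ∪ Set.range g) := hgen ▸ Algebra.mem_top
    have hidem : ∀ x x', ∃ s ∈ S, e x' * e x = s * e x := fun x x' => by
      by_cases h : x' = x
      · subst h
        exact ⟨1, S.one_mem, by rw [one_mul, (he.idem x').eq]⟩
      · exact ⟨0, S.zero_mem, by rw [he.ortho h, zero_mul]⟩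
    induction ha using Algebra.adjoin_induction with
    | mem a ha =>
      intro x x'
      rcases ha with ⟨y, rfl⟩ | ⟨i, rfl⟩
      · obtain ⟨s, hs, h⟩ := hidem y x'
        obtain ⟨t, ht, h'⟩ := hidem x y
        exact ⟨s * t, S.mul_mem hs ht, by rw [h, mul_assoc, h', mul_assoc]⟩
      · obtain ⟨z, hz⟩ := hg i x
        by_cases h : x' = z
        · subst h
          exact ⟨g i, hS i, by rw [mul_assoc, hz, ← mul_assoc, (he.idem x').eq]⟩
        · exact ⟨0, S.zero_mem, by rw [mul_assoc, hz, ← mul_assoc, he.ortho h]; simp⟩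
    | algebraMap r =>
      intro x x'
      obtain ⟨s, hs, h⟩ := hidem x x'
      refine ⟨algebraMap F A r * s, S.mul_mem (S.algebraMap_mem r) hs, ?_⟩
      rw [← Algebra.commutes, mul_assoc, h, mul_assoc]
    | add a b _ _ ha hb =>
      intro x x'
      obtain ⟨s, hs, h⟩ := ha x x'
      obtain ⟨t, ht, h'⟩ := hb x x'
      exact ⟨s + t, S.add_mem hs ht, by rw [mul_add, add_mul, h, h', add_mul]⟩
    | mul a b _ _ ha hb =>
      intro x x'
      choose t ht h' using fun z => hb x z
      choose s hs h using fun z => ha z x'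
      refine ⟨∑ z, s z * t z, S.sum_mem fun z _ => S.mul_mem (hs z) (ht z), ?_⟩
      calc e x' * (a * b) * e x = e x' * a * (∑ z, e z) * b * e x := by
            rw [hsum]; noncomm_ring
        _ = ∑ z, (e x' * a * e z) * b * e x := by
            simp only [Finset.mul_sum, Finset.sum_mul]
        _ = ∑ z, s z * (e z * b * e x) := by
            refine Finset.sum_congr rfl fun z _ => ?_
            rw [h z]; noncomm_ring
        _ = _ := by
            rw [Finset.sum_mul]
            exact Finset.sum_congr rfl fun z _ => by rw [h', mul_assoc]
  choose s hs h using key x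
  refine ⟨∑ z, s z, S.sum_mem fun z _ => hs z, ?_⟩
  rw [Finset.sum_mul, ← Finset.sum_congr rfl fun z _ => h z, ← Finset.sum_mul, ← Finset.sum_mul,
    hsum, one_mul]

open Classical in
/-- In the situation of `exists_mul_idem_eq`, let `φ` be an endomorphism with `φ (e x) = e (τ x)`,
and let the fibres of `q` be classes on which properties stable under `τ` are constant. If `S`
consists of fixed points of `φ` and contains the sums of the `e x` over the fibres of `q`, then it
contains all fixed points: if `a` is fixed and `a e(x) = s e(x)` with `s ∈ S`, then the same holds,
with the same `s`, for all `x` in the fibre, and `a` is determined by the products `a e(x)`. -/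
theorem mem_of_fixed {F A X I Y : Type*} [Field F] [Ring A] [Algebra F A] [Fintype X] [Fintype Y]
    {e : X → A} (he : OrthogonalIdempotents e) (hsum : ∑ x, e x = 1) {g : I → A}
    (hg : ∀ i x, ∃ x', g i * e x = e x' * g i)
    (hgen : Algebra.adjoin F (Set.range e ∪ Set.range g) = ⊤)
    (φ : A →ₐ[F] A) (τ : X → X) (hφ : ∀ x, φ (e x) = e (τ x))
    (q : X → Y) (hq : Function.Surjective q)
    (hqτ : ∀ P : X → Prop, (∀ x, P x → P (τ x)) → ∀ x x', q x = q x' → P x → P x')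
    (S : Subalgebra F A) (hSφ : ∀ s ∈ S, φ s = s) (hSg : ∀ i, g i ∈ S)
    (hSe : ∀ y, ∑ x with q x = y, e x ∈ S) (a : A) (ha : φ a = a) : a ∈ S := by
  choose r hr using hq
  choose s hs h using fun x => exists_mul_idem_eq he hsum hg hgen S hSg a x
  have key : ∀ x, a * e x = s (r (q x)) * e x := fun x => by
    refine hqτ (fun x' => a * e x' = s (r (q x)) * e x') (fun x' hx' => ?_) (r (q x)) x (hr _)
      (h _)
    have := congrArg φ hx'
    rwa [map_mul, map_mul, ha, hSφ _ (hs _), hφ] at this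
  have : a = ∑ y, s (r y) * ∑ x with q x = y, e x := by
    calc a = a * ∑ x, e x := by rw [hsum, mul_one]
      _ = ∑ x, s (r (q x)) * e x := by
        rw [Finset.mul_sum]
        exact Finset.sum_congr rfl fun x _ => key x
      _ = ∑ y, ∑ x with q x = y, s (r (q x)) * e x := (Finset.sum_fiberwise _ q _).symm
      _ = _ := Finset.sum_congr rfl fun y _ => by
        rw [Finset.mul_sum]
        refine Finset.sum_congr rfl fun x hx => ?_
        rw [(Finset.mem_filter.1 hx).2]
  rw [this]
  exact S.sum_mem fun y _ => S.mul_mem (hs _) (hSe y)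

/-! ### Tuples and their classes -/

section Classes

variable {K : Type u} {n : ℕ} {Γ : Digraph K}

theorem tupData_isPlaceAction (β : K →₀ ℕ) : (tupData (n := n) Γ β).IsPlaceAction where
  swap_swap a k := Subtype.ext <| funext fun c => by simp [tupData]
  swap_of_same a k h := Subtype.ext <| funext fun c => by
    change k.1 a.castSucc = k.1 a.succ at h
    simp only [tupData, Function.comp_apply, Equiv.swap_apply_def]
    split_ifs <;> simp_all
  swap_comm a b h k := Subtype.ext <| funext fun c => by
    have h₁ : a.castSucc ≠ b.castSucc := by simp [Fin.ext_iff]; omega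
    have h₂ : a.castSucc ≠ b.succ := by simp [Fin.ext_iff]; omega
    have h₃ : a.succ ≠ b.castSucc := by simp [Fin.ext_iff]; omega
    have h₄ : a.succ ≠ b.succ := by simp [Fin.ext_iff]; omega
    have hdisj : Equiv.Perm.Disjoint (Equiv.swap b.castSucc b.succ)
        (Equiv.swap a.castSucc a.succ) := fun d => ?_
    · exact congrArg k.1 (DFunLike.congr_fun hdisj.commute.eq c)
    by_cases hd : d = b.castSucc ∨ d = b.succ
    · exact Or.inr (by rcases hd with rfl | rfl <;> simp [Equiv.swap_apply_of_ne_of_ne, *, Ne.symm])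
    · push Not at hd
      exact Or.inl (Equiv.swap_apply_of_ne_of_ne hd.1 hd.2)
  swap_braid a b h k := Subtype.ext <| funext fun c => by
    have hb : b.castSucc = a.succ := Fin.ext (by simp [h])
    have h₁ : a.castSucc ≠ a.succ := by simp [Fin.ext_iff]
    have h₂ : a.castSucc ≠ b.succ := by simp [Fin.ext_iff, h]; omega
    have h₃ : a.succ ≠ b.succ := by simp [Fin.ext_iff, h]
    simp only [tupData, Function.comp_apply, Equiv.swap_apply_def, hb]
    clear h
    split_ifs <;> simp_all
  swap_braid_of_same a b h k hs := Subtype.ext <| funext fun c => by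
    change k.1 b.succ = k.1 a.castSucc at hs
    have hb : b.castSucc = a.succ := Fin.ext (by simp [h])
    have h₁ : a.castSucc ≠ a.succ := by simp [Fin.ext_iff]
    have h₂ : a.castSucc ≠ b.succ := by simp [Fin.ext_iff, h]; omega
    have h₃ : a.succ ≠ b.succ := by simp [Fin.ext_iff, h]
    simp only [tupData, Function.comp_apply, Equiv.swap_apply_def, hb]
    split_ifs <;> simp_all

variable {p : ℕ} (σ : QuiverAut Γ p) [NeZero p] (α : K →₀ ℕ)

theorem classData_swap_swap (a : Fin n) (γ : OrbClass σ n α) :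
    (classData σ n α).swap a ((classData σ n α).swap a γ) = γ := by
  induction γ using Quot.ind with
  | mk k =>
    refine congrArg (Quot.mk _) (Subtype.ext <| funext fun c => ?_)
    simp

/-- The inclusion of `K^β` in `K^[α]`. -/
def Tup.toOrbTup (β : Orb σ α) (k : Tup n β.1) : OrbTup σ n α := ⟨k.1, β.1, β.2, k.2⟩

omit [NeZero p] in
theorem Tup.toOrbTup_injective (β : Orb σ α) :
    Function.Injective (Tup.toOrbTup (n := n) σ α β) := fun _ _ h =>
  Subtype.ext (congrArg (fun k : OrbTup σ n α => k.1) h)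

/-- The map `K^β → K^[α]_σ`, compatible with the strand data, sending a tuple to its class. -/
def tupClass (β : Orb σ α) : StrandHom (tupData (n := n) Γ β.1) (classData σ n α) where
  toFun k := OrbClass.mk σ n α (k.toOrbTup σ α β)
  swap _ _ := rfl
  same _ _ _ := Iff.rfl
  edge _ _ _ := Iff.rfl

theorem exists_tupClass_eq (γ : OrbClass σ n α) :
    ∃ (β : Orb σ α) (k : Tup n β.1), (tupClass σ α β).toFun k = γ := by
  induction γ using Quot.ind with
  | mk k =>
    obtain ⟨β, hβ, hk⟩ := k.2
    exact ⟨⟨β, hβ⟩, ⟨k.1, hk⟩, rfl⟩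

theorem OrbTup.sigma_iterate (k : OrbTup σ n α) : (OrbTup.sigma σ n α)^[p] k = k := by
  have h : ∀ m, ((OrbTup.sigma σ n α)^[m] k).1 = (σ.perm ^ m) ∘ k.1 := fun m => by
    induction m with
    | zero => rfl
    | succ m ih =>
      rw [Function.iterate_succ_apply', pow_succ', Equiv.Perm.coe_mul, Function.comp_assoc, ← ih]
      rfl
  exact Subtype.ext (by rw [h, σ.pow_eq_one]; rfl)

/-- A property of tuples preserved by `σ` depends only on the class, since `σ` has finite order. -/
theorem OrbTup.of_mk_eq (P : OrbTup σ n α → Prop) (hP : ∀ k, P k → P (OrbTup.sigma σ n α k))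
    (k k' : OrbTup σ n α) (h : OrbClass.mk σ n α k = OrbClass.mk σ n α k') (hk : P k) : P k' := by
  have hit : ∀ m k, P k → P ((OrbTup.sigma σ n α)^[m] k) := fun m k hk => by
    induction m with
    | zero => exact hk
    | succ m ih => rw [Function.iterate_succ_apply']; exact hP _ ih
  have hiff : ∀ k, P k = P (OrbTup.sigma σ n α k) := fun k => propext ⟨hP k, fun h => by
    have := hit (p - 1) _ h
    rwa [← Function.iterate_succ_apply, Nat.succ_eq_add_one,
      Nat.sub_add_cancel (Nat.one_le_iff_ne_zero.2 (NeZero.ne p)), OrbTup.sigma_iterate] at this⟩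
  have := congrArg (Quot.lift P (by rintro k _ rfl; exact hiff k)) h
  exact this.mp hk

theorem HasContent.unique {k : Fin (n + 1) → K} {β β' : K →₀ ℕ} (h : HasContent k β)
    (h' : HasContent k β') : β = β' := Finsupp.ext fun x => (h x).symm.trans (h' x)

end Classes

/-! ### The algebra of an orbit and its generators -/

section OrbitAlgebra

variable {K : Type u} {Γ : Digraph K} {p : ℕ} (σ : QuiverAut Γ p) [NeZero p]
  (F : Type v) [Field F] (n : ℕ) (α : K →₀ ℕ)

omit [NeZero p] in
open Classical in
theorem eTup_toOrbTup (β : Orb σ α) (k : Tup n β.1) :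
    eTup σ F n α (k.toOrbTup σ α β) = Pi.single β (Pres.gen F _ (.e k)) := by
  funext β'
  by_cases h : β' = β
  · subst h
    rw [Pi.single_eq_same, eTup]
    exact dif_pos k.2
  · rw [Pi.single_eq_of_ne h, eTup, dif_neg]
    exact fun h' => h (Subtype.ext (HasContent.unique h' k.2))

open Classical in
theorem sum_eTup_apply (P : OrbTup σ n α → Prop) (β : Orb σ α) :
    (∑ k with P k, eTup σ F n α k) β =
      ∑ k : Tup n β.1 with P (k.toOrbTup σ α β), Pres.gen F (tupData Γ β.1) (.e k) := by
  rw [Finset.sum_apply, Finset.sum_filter, Finset.sum_filter]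
  refine (Fintype.sum_of_injective _ (Tup.toOrbTup_injective σ α β) _ _ ?_ ?_).symm
  · intro k hk
    have : ¬ HasContent k.1 β.1 := fun h => hk ⟨⟨k.1, h⟩, rfl⟩
    rw [eTup, dif_neg this, ite_self]
  · intro k
    rw [eTup_toOrbTup, Pi.single_eq_same]

theorem sum_eTup : ∑ k, eTup σ F n α k = 1 := by
  classical
  funext β
  have h := sum_eTup_apply σ F n α (fun _ => True) β
  simp only [Finset.filter_true] at h
  rw [h]
  simpa using satisfies_gen (F := F) (tupData Γ β.1) _ _ Rel.sum_e

omit [NeZero p] in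
theorem orthogonalIdempotents_eTup : OrthogonalIdempotents (eTup σ F n α) := by
  classical
  have hβ : ∀ k : OrbTup σ n α, ∃ (β : Orb σ α) (l : Tup n β.1), k = l.toOrbTup σ α β :=
    fun k => by
      obtain ⟨β, hβ, hk⟩ := k.2
      exact ⟨⟨β, hβ⟩, ⟨k.1, hk⟩, rfl⟩
  constructor
  · intro k
    obtain ⟨β, k, rfl⟩ := hβ k
    rw [IsIdempotentElem, eTup_toOrbTup, ← Pi.single_mul]
    congr 1
    simpa using satisfies_gen (F := F) (tupData Γ β.1) _ _ (Rel.e_idem k)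
  · intro k k' hne
    obtain ⟨β, k, rfl⟩ := hβ k
    change eTup σ F n α _ * eTup σ F n α k' = 0
    rw [eTup_toOrbTup]
    funext β'
    by_cases h : β' = β
    · subst h
      rw [Pi.mul_apply, Pi.single_eq_same, eTup]
      split_ifs with h'
      · refine Eq.trans ?_ (Eq.trans (satisfies_gen (F := F) (tupData Γ β'.1) _ _
          (Rel.e_orth k ⟨k'.1, h'⟩ fun h => hne ?_)) (map_zero _))
        · simp
        · exact Subtype.ext (congrArg (fun k : Tup n β'.1 => k.1) h)
      · rw [mul_zero]; rfl
    · rw [Pi.mul_apply, Pi.single_eq_of_ne h, zero_mul]; rfl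

/-- The elements `y_a` and `ψ_a` of `R_[α](Γ)`. -/
noncomputable def yPsiOrb : Fin (n + 1) ⊕ Fin n → QHAOrb σ F n α :=
  Sum.elim (yOrb σ F n α) (psiOrb σ F n α)

omit [NeZero p] in
theorem exists_yPsiOrb_mul_eTup (i : Fin (n + 1) ⊕ Fin n) (k : OrbTup σ n α) :
    ∃ k', yPsiOrb σ F n α i * eTup σ F n α k = eTup σ F n α k' * yPsiOrb σ F n α i := by
  classical
  obtain ⟨β, k, rfl⟩ : ∃ (β : Orb σ α) (l : Tup n β.1), k = l.toOrbTup σ α β := by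
    obtain ⟨β, hβ, hk⟩ := k.2
    exact ⟨⟨β, hβ⟩, ⟨k.1, hk⟩, rfl⟩
  have hrel := satisfies_gen (F := F) (tupData (n := n) Γ β.1)
  rcases i with a | a
  · refine ⟨k.toOrbTup σ α β, ?_⟩
    rw [eTup_toOrbTup]
    funext β'
    by_cases h : β' = β
    · subst h
      simpa [yPsiOrb, yOrb] using hrel _ _ (Rel.y_e a k)
    · simp [h]
  · refine ⟨((tupData Γ β.1).swap a k).toOrbTup σ α β, ?_⟩
    rw [eTup_toOrbTup, eTup_toOrbTup]
    funext β'
    by_cases h : β' = β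
    · subst h
      simpa [yPsiOrb, psiOrb] using hrel _ _ (Rel.psi_e a k)
    · simp [h]

/-- `R_[α](Γ)` is generated by the `e(k)`, `y_a`, `ψ_a`: the unit of each summand is a sum of
elements `e(k)`. -/
theorem adjoin_eTup_yPsiOrb :
    Algebra.adjoin F (Set.range (eTup σ F n α) ∪ Set.range (yPsiOrb σ F n α)) = ⊤ := by
  classical
  set S := Algebra.adjoin F (Set.range (eTup σ F n α) ∪ Set.range (yPsiOrb σ F n α)) with hS
  have he : ∀ k, eTup σ F n α k ∈ S := fun k => Algebra.subset_adjoin (Or.inl ⟨k, rfl⟩)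
  have hg : ∀ i, yPsiOrb σ F n α i ∈ S := fun i => Algebra.subset_adjoin (Or.inr ⟨i, rfl⟩)
  have hone : ∀ β : Orb σ α, (Pi.single β 1 : QHAOrb σ F n α) ∈ S := fun β => by
    have h1 : ∑ k : Tup n β.1, Pres.gen F (tupData Γ β.1) (.e k) = 1 := by
      simpa using satisfies_gen (F := F) (tupData Γ β.1) _ _ Rel.sum_e
    have : (Pi.single β 1 : QHAOrb σ F n α) =
        ∑ k : Tup n β.1, eTup σ F n α (k.toOrbTup σ α β) := by
      simp only [eTup_toOrbTup]
      rw [← h1]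
      exact map_sum (AddMonoidHom.single (fun β : Orb σ α => QHA F n Γ β.1) β) _ _
    rw [this]
    exact S.sum_mem fun k _ => he _
  have hsingle : ∀ (β : Orb σ α) (w : FreeAlgebra F (Gen n (Tup n β.1))),
      (Pi.single β (RingQuot.mkAlgHom F (Rel F (tupData Γ β.1)) w) : QHAOrb σ F n α) ∈ S := by
    intro β w
    induction w using FreeAlgebra.induction with
    | grade0 r =>
      have : (Pi.single β (RingQuot.mkAlgHom F (Rel F (tupData Γ β.1))
          (algebraMap F (FreeAlgebra F (Gen n (Tup n β.1))) r)) : QHAOrb σ F n α) =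
          r • Pi.single β 1 := by
        rw [AlgHom.commutes, Algebra.algebraMap_eq_smul_one, Pi.single_smul]
      rw [this]
      exact S.smul_mem (hone β) r
    | grade1 x =>
      cases x with
      | e k =>
        have h := he (k.toOrbTup σ α β)
        rwa [eTup_toOrbTup] at h
      | y a =>
        have : (Pi.single β (Pres.gen F (tupData Γ β.1) (.y a)) : QHAOrb σ F n α) =
            Pi.single β 1 * yPsiOrb σ F n α (Sum.inl a) := by
          funext β'
          by_cases h : β' = β
          · subst h; simp [yPsiOrb, yOrb]
          · simp [h]
        exact this ▸ S.mul_mem (hone β) (hg _)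
      | psi a =>
        have : (Pi.single β (Pres.gen F (tupData Γ β.1) (.psi a)) : QHAOrb σ F n α) =
            Pi.single β 1 * yPsiOrb σ F n α (Sum.inr a) := by
          funext β'
          by_cases h : β' = β
          · subst h; simp [yPsiOrb, psiOrb]
          · simp [h]
        exact this ▸ S.mul_mem (hone β) (hg _)
    | mul a b ha hb =>
      rw [map_mul, Pi.single_mul]
      exact S.mul_mem ha hb
    | add a b ha hb =>
      rw [map_add, Pi.single_add]
      exact S.add_mem ha hb
  have := (Orb.finite σ α).fintype
  rw [eq_top_iff]
  intro x _
  rw [← Finset.univ_sum_single x]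
  refine S.sum_mem fun β _ => ?_
  obtain ⟨w, hw⟩ := RingQuot.mkAlgHom_surjective F (Rel F (tupData Γ β.1)) (x β)
  exact hw ▸ hsingle β w

/-- The elements `e(γ)`, `y_a`, `ψ_a` of `R_[α](Γ)^σ`. -/
noncomputable def genFix : Gen n (OrbClass σ n α) → fixedAffine σ F n α
  | .e γ => eFix σ F n α γ
  | .y a => yFix σ F n α a
  | .psi a => ⟨psiOrb σ F n α a, sigmaOrb_psiOrb σ F n α a⟩

theorem genFix_apply (x : Gen n (OrbClass σ n α)) (β : Orb σ α) :
    (genFix σ F n α x : QHAOrb σ F n α) β =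
      sumFibre (tupClass σ α β).toFun (Pres.gen F (tupData Γ β.1)) x := by
  classical
  cases x with
  | e γ =>
    exact sum_eTup_apply σ F n α (fun k => OrbClass.mk σ n α k = γ) β
  | y a => rfl
  | psi a => rfl

/-- The projection of `R_[α](Γ)^σ` to the summand `R_β(Γ)`. -/
noncomputable def fixedEval (β : Orb σ α) : fixedAffine σ F n α →ₐ[F] QHA F n Γ β.1 :=
  (Pi.evalAlgHom F (fun β : Orb σ α => QHA F n Γ β.1) β).comp (fixedAffine σ F n α).val

theorem fixedEval_lift (β : Orb σ α) (w : FreeAlgebra F (Gen n (OrbClass σ n α))) :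
    (FreeAlgebra.lift F (genFix σ F n α) w : QHAOrb σ F n α) β =
      FreeAlgebra.lift F (sumFibre (tupClass σ α β).toFun (Pres.gen F (tupData Γ β.1))) w := by
  have h : (fixedEval σ F n α β).comp (FreeAlgebra.lift F (genFix σ F n α)) =
      FreeAlgebra.lift F (sumFibre (tupClass σ α β).toFun (Pres.gen F (tupData Γ β.1))) := by
    ext x
    simp [fixedEval, genFix_apply]
  exact DFunLike.congr_fun h w

theorem satisfies_genFix : Satisfies F (classData σ n α) (genFix σ F n α) := fun l r h => by
  apply Subtype.ext
  funext β
  rw [fixedEval_lift, fixedEval_lift]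
  exact (satisfies_gen (tupData Γ β.1)).sum_fibre (tupClass σ α β)
    (tupData_isPlaceAction β.1).swap_swap (classData_swap_swap σ α) l r h

/-- The algebra `R_[α](Γ)^σ` is generated by the `e(γ)`, `y_a`, `ψ_a`. -/
theorem lift_genFix_surjective : Function.Surjective (FreeAlgebra.lift F (genFix σ F n α)) := by
  classical
  intro a
  set S := ((fixedAffine σ F n α).val.comp (FreeAlgebra.lift F (genFix σ F n α))).range
  have hgen : ∀ x, (genFix σ F n α x : QHAOrb σ F n α) ∈ S := fun x =>
    ⟨FreeAlgebra.ι F x, by simp⟩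
  have : (a : QHAOrb σ F n α) ∈ S := by
    refine mem_of_fixed (orthogonalIdempotents_eTup σ F n α) (sum_eTup σ F n α)
      (exists_yPsiOrb_mul_eTup σ F n α) (adjoin_eTup_yPsiOrb σ F n α) (sigmaOrb σ F n α)
      (OrbTup.sigma σ n α) (sigmaOrb_eTup σ F n α) (OrbClass.mk σ n α) Quot.mk_surjective
      (OrbTup.of_mk_eq σ α) S ?_ ?_ ?_ _ a.2
    · rintro _ ⟨w, rfl⟩
      exact (FreeAlgebra.lift F (genFix σ F n α) w).2
    · rintro (i | i)
      · exact hgen (.y i)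
      · exact hgen (.psi i)
    · intro γ
      exact hgen (.e γ)
  obtain ⟨w, hw⟩ := this
  exact ⟨w, Subtype.ext hw⟩

end OrbitAlgebra

/-! ### The cyclotomic quotients -/

section Cyclotomic

variable {K : Type u} {Γ : Digraph K} {p : ℕ} (σ : QuiverAut Γ p) [NeZero p]
  (F : Type v) [Field F] (n : ℕ) (α Λ : K →₀ ℕ) (hΛ : ∀ k, Λ k = Λ (σ.perm k))

omit [NeZero p] in
theorem projOrb_surjective : Function.Surjective (projOrb σ F n α Λ) := fun x => by
  choose y hy using fun β => RingQuot.mkAlgHom_surjective F (cycloRel F n Γ Λ β.1) (x β)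
  exact ⟨y, funext hy⟩

/-- The restriction of the canonical projection to the fixed points. -/
noncomputable def projFixed : fixedAffine σ F n α →ₐ[F] fixedCyclo σ F n α Λ hΛ :=
  ((projOrb σ F n α Λ).comp (fixedAffine σ F n α).val).codRestrict _ fun h => by
    change sigmaCycloOrb σ F n α Λ hΛ (projOrb σ F n α Λ h) = projOrb σ F n α Λ h
    rw [sigmaCycloOrb_projOrb, show sigmaOrb σ F n α h = h from h.2]

theorem projFixed_cyclo (γ : OrbClass σ n α) :
    projFixed σ F n α Λ hΛ
      (yFix σ F n α 0 ^ classLevel σ n α Λ hΛ γ * eFix σ F n α γ) = 0 := by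
  classical
  apply Subtype.ext
  funext β
  have h : (eFix σ F n α γ : QHAOrb σ F n α) β = _ := genFix_apply σ F n α (.e γ) β
  change RingQuot.mkAlgHom F (cycloRel F n Γ Λ β.1)
    ((Pres.gen F (tupData Γ β.1) (.y 0)) ^ classLevel σ n α Λ hΛ γ *
      (eFix σ F n α γ : QHAOrb σ F n α) β) = 0
  rw [h]
  simp only [sumFibre, Finset.mul_sum, map_sum]
  refine Finset.sum_eq_zero fun k hk => ?_
  obtain rfl := (Finset.mem_filter.1 hk).2
  exact (RingQuot.mkAlgHom_rel F ⟨k, rfl, rfl⟩).trans (map_zero _)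

/-- The homomorphism `(R_[α](Γ)^σ)^Λ → R_[α]^Λ(Γ)^σ` induced by the canonical projection. -/
noncomputable def cycloOfFixedHom : CycloOfFixed σ F n α Λ hΛ →ₐ[F] fixedCyclo σ F n α Λ hΛ :=
  RingQuot.liftAlgHom F ⟨projFixed σ F n α Λ hΛ, by
    rintro _ _ ⟨γ, rfl, rfl⟩
    rw [projFixed_cyclo, map_zero]⟩

theorem cycloOfFixedHom_mk (h : fixedAffine σ F n α) :
    cycloOfFixedHom σ F n α Λ hΛ (RingQuot.mkAlgHom F (cycloFixRel σ F n α Λ hΛ) h) =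
      projFixed σ F n α Λ hΛ h :=
  RingQuot.liftAlgHom_mkAlgHom_apply F _ _ _

/-- The homomorphism from the presented algebra to `(R_[α](Γ)^σ)^Λ` sending generators to
generators. -/
noncomputable def fixedPresHom : FixedPres σ F n α Λ hΛ →ₐ[F] CycloOfFixed σ F n α Λ hΛ :=
  RingQuot.liftAlgHom F ⟨(RingQuot.mkAlgHom F (cycloFixRel σ F n α Λ hΛ)).comp
      (FreeAlgebra.lift F (genFix σ F n α)), by
    rintro _ _ (⟨_, _, h⟩ | γ)
    · exact congrArg (RingQuot.mkAlgHom F (cycloFixRel σ F n α Λ hΛ))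
        (satisfies_genFix σ F n α _ _ h)
    · rw [map_zero, ← map_zero (RingQuot.mkAlgHom F (cycloFixRel σ F n α Λ hΛ))]
      exact RingQuot.mkAlgHom_rel F ⟨γ, by simp [genFix], rfl⟩⟩

theorem fixedPresHom_mk (w : FreeAlgebra F (Gen n (OrbClass σ n α))) :
    fixedPresHom σ F n α Λ hΛ (RingQuot.mkAlgHom F _ w) =
      RingQuot.mkAlgHom F (cycloFixRel σ F n α Λ hΛ) (FreeAlgebra.lift F (genFix σ F n α) w) :=
  RingQuot.liftAlgHom_mkAlgHom_apply F _ _ _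

theorem fixedPresHom_surjective : Function.Surjective (fixedPresHom σ F n α Λ hΛ) := fun x => by
  obtain ⟨h, rfl⟩ := RingQuot.mkAlgHom_surjective F _ x
  obtain ⟨w, rfl⟩ := lift_genFix_surjective σ F n α h
  exact ⟨_, fixedPresHom_mk σ F n α Λ hΛ w⟩

theorem cycloOfFixedHom_surjective : Function.Surjective (cycloOfFixedHom σ F n α Λ hΛ) := by
  classical
  intro a
  set π := projOrb σ F n α Λ
  set S := ((fixedCyclo σ F n α Λ hΛ).val.comp (cycloOfFixedHom σ F n α Λ hΛ)).range
  have hS : ∀ h : fixedAffine σ F n α, π h ∈ S := fun h =>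
    ⟨RingQuot.mkAlgHom F _ h, by
      change ((cycloOfFixedHom σ F n α Λ hΛ _ : fixedCyclo σ F n α Λ hΛ) :
        CycloQHAOrb σ F n Λ α) = _
      rw [cycloOfFixedHom_mk]
      rfl⟩
  have : (a : CycloQHAOrb σ F n Λ α) ∈ S := by
    refine mem_of_fixed ((orthogonalIdempotents_eTup σ F n α).map π.toRingHom)
      (g := π ∘ yPsiOrb σ F n α)
      ?_ ?_ ?_ (sigmaCycloOrb σ F n α Λ hΛ)
      (OrbTup.sigma σ n α) ?_ (OrbClass.mk σ n α) Quot.mk_surjective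
      (OrbTup.of_mk_eq σ α) S ?_ ?_ ?_ (a : CycloQHAOrb σ F n Λ α)
      (show sigmaCycloOrb σ F n α Λ hΛ a = a from a.2)
    · change ∑ k, π (eTup σ F n α k) = 1
      rw [← map_sum, sum_eTup, map_one]
    · intro i k
      obtain ⟨k', h⟩ := exists_yPsiOrb_mul_eTup σ F n α i k
      refine ⟨k', ?_⟩
      change π _ * π _ = π _ * π _
      rw [← map_mul, h, map_mul]
    · change Algebra.adjoin F (Set.range (π ∘ eTup σ F n α) ∪ _) = ⊤
      rw [Set.range_comp, Set.range_comp, ← Set.image_union, ← AlgHom.map_adjoin,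
        adjoin_eTup_yPsiOrb, Algebra.map_top]
      exact (AlgHom.range_eq_top _).2 (projOrb_surjective σ F n α Λ)
    · intro k
      exact (sigmaCycloOrb_projOrb σ F n α Λ hΛ _).trans (congrArg π (sigmaOrb_eTup σ F n α k))
    · rintro _ ⟨w, rfl⟩
      exact (cycloOfFixedHom σ F n α Λ hΛ w).2
    · rintro (i | i)
      · exact hS (genFix σ F n α (.y i))
      · exact hS (genFix σ F n α (.psi i))
    · intro γ
      have h := hS (genFix σ F n α (.e γ))
      simp only [genFix, eFix, eClass, map_sum] at h
      exact h
  obtain ⟨w, hw⟩ := this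
  exact ⟨w, Subtype.ext hw⟩

theorem lift_fixedPresGen : FreeAlgebra.lift F (fixedPresGen σ F n α Λ hΛ) =
    RingQuot.mkAlgHom F (CycloRel F (classData σ n α) (classLevel σ n α Λ hΛ)) := by
  ext
  simp [CycloPres.gen]

theorem satisfies_fixedPresGen :
    Satisfies F (classData σ n α) (fixedPresGen σ F n α Λ hΛ) := fun l r h => by
  rw [lift_fixedPresGen]
  exact RingQuot.mkAlgHom_rel F (.affine l r h)

section Representation

variable {n Λ hΛ} {R : Type w} [Ring R] [Algebra F R] {g : Gen n (OrbClass σ n α) → R}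

/-- The representation of `R_β^Λ(Γ)` on the sum over `k ∈ K^β` of the right ideals `e(γ) R`, where
`γ` is the class of `k`, for an algebra `R` with elements `g` satisfying the quiver Hecke relations
for classes and the cyclotomic relations. -/
noncomputable def cycloRep
    (hg : Satisfies F (classData σ n α) g)
    (hcyclo : ∀ γ, g (.y 0) ^ classLevel σ n α Λ hΛ γ * g (.e γ) = 0)
    (β : Orb σ α) : CycloQHA F n Γ Λ β.1 →ₐ[F]
    Module.End F (fibreModule F (tupClass σ α β).toFun g) :=
  RingQuot.liftAlgHom F ⟨RingQuot.liftAlgHom F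
    ⟨FreeAlgebra.lift F (fibreGen (tupClass σ α β) (tupData_isPlaceAction β.1).swap_swap hg),
      fun l r h => satisfies_fibreGen (tupClass σ α β) (tupData_isPlaceAction β.1) hg l r h⟩, by
    classical
    rintro _ _ ⟨k, rfl, rfl⟩
    rw [map_mul, map_pow, map_zero, Pres.gen, Pres.gen, RingQuot.liftAlgHom_mkAlgHom_apply,
      RingQuot.liftAlgHom_mkAlgHom_apply, FreeAlgebra.lift_ι_apply, FreeAlgebra.lift_ι_apply]
    ext f : 1
    apply Subtype.ext
    have hpow : ∀ (m : ℕ) (f : fibreModule F (tupClass σ α β).toFun g),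
        ((fibreGen (tupClass σ α β) (tupData_isPlaceAction β.1).swap_swap hg (.y 0) ^ m) f).1 =
          g (.y 0) ^ m • f.1 := fun m f => by
      induction m with
      | zero => simp
      | succ m ih =>
        rw [pow_succ', Module.End.mul_apply, coe_fibreGen_y, ih, smul_smul, ← pow_succ']
    have h0 : g (.y 0) ^ Λ (k.1 0) * g (.e ((tupClass σ α β).toFun k)) = 0 :=
      hcyclo ((tupClass σ α β).toFun k)
    rw [Module.End.mul_apply, hpow, coe_fibreGen_e, smul_single_eq, ← f.2 k, ← mul_assoc, h0,
      zero_mul, Pi.single_zero]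
    rfl⟩

theorem cycloRep_gen
    (hg : Satisfies F (classData σ n α) g)
    (hcyclo : ∀ γ, g (.y 0) ^ classLevel σ n α Λ hΛ γ * g (.e γ) = 0)
    (β : Orb σ α) (x : Gen n (Tup n β.1)) :
    cycloRep σ F α hg hcyclo β (RingQuot.mkAlgHom F (cycloRel F n Γ Λ β.1) (Pres.gen F _ x)) =
      fibreGen (tupClass σ α β) (tupData_isPlaceAction β.1).swap_swap hg x := by
  rw [cycloRep, RingQuot.liftAlgHom_mkAlgHom_apply]
  rw [Pres.gen, RingQuot.liftAlgHom_mkAlgHom_apply, FreeAlgebra.lift_ι_apply]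

/-- A word in the generators indexed by classes whose image in `R_β^Λ(Γ)` vanishes acts as zero on
the representation `cycloRep`, hence kills `e(γ)` in `R` for each class `γ` meeting `K^β`. -/
theorem lift_mul_eq_zero_of_mk
    (hg : Satisfies F (classData σ n α) g)
    (hcyclo : ∀ γ, g (.y 0) ^ classLevel σ n α Λ hΛ γ * g (.e γ) = 0)
    (β : Orb σ α) (w : FreeAlgebra F (Gen n (OrbClass σ n α)))
    (hw : RingQuot.mkAlgHom F (cycloRel F n Γ Λ β.1) (FreeAlgebra.lift F
      (sumFibre (tupClass σ α β).toFun (Pres.gen F (tupData Γ β.1))) w) = 0) (k : Tup n β.1) :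
    FreeAlgebra.lift F g w * g (.e ((tupClass σ α β).toFun k)) = 0 := by
  refine lift_mul_eq_zero_of_fibreGen (tupClass σ α β)
    (tupData_isPlaceAction β.1).swap_swap hg ?_ k
  have hcomp : ((cycloRep σ F α hg hcyclo β).comp
      (RingQuot.mkAlgHom F (cycloRel F n Γ Λ β.1))).comp (FreeAlgebra.lift F
        (sumFibre (tupClass σ α β).toFun (Pres.gen F (tupData Γ β.1)))) =
      FreeAlgebra.lift F (sumFibre (tupClass σ α β).toFun (fibreGen (tupClass σ α β)
        (tupData_isPlaceAction β.1).swap_swap hg)) := by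
    refine FreeAlgebra.hom_ext (funext fun x => ?_)
    simp only [Function.comp_apply, AlgHom.coe_comp, FreeAlgebra.lift_ι_apply]
    refine (map_sumFibre (tupClass σ α β).toFun (Pres.gen F (tupData Γ β.1))
      ((cycloRep σ F α hg hcyclo β).comp
        (RingQuot.mkAlgHom F (cycloRel F n Γ Λ β.1))).toRingHom.toAddMonoidHom x).trans ?_
    congr 1
    funext y
    exact cycloRep_gen σ F α hg hcyclo β y
  rw [← hcomp, AlgHom.comp_apply, AlgHom.comp_apply, hw, map_zero]

end Representation

theorem fixedPresGen_cyclo (γ : OrbClass σ n α) :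
    fixedPresGen σ F n α Λ hΛ (.y 0) ^ classLevel σ n α Λ hΛ γ *
      fixedPresGen σ F n α Λ hΛ (.e γ) = 0 := by
  have := RingQuot.mkAlgHom_rel F (CycloRel.cyclo (F := F) (D := classData σ n α)
    (lvl := classLevel σ n α Λ hΛ) γ)
  rwa [map_mul, map_pow, map_zero] at this

/-- The presented algebra embeds in `R_[α]^Λ(Γ)^σ`: an element of the kernel has image zero in
each `R_β^Λ(Γ)`, hence kills all the `e(γ)` by `lift_mul_eq_zero_of_mk`, and these have sum `1`. -/
theorem cycloOfFixedHom_comp_fixedPresHom_injective :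
    Function.Injective ((cycloOfFixedHom σ F n α Λ hΛ).comp (fixedPresHom σ F n α Λ hΛ)) := by
  rw [injective_iff_map_eq_zero]
  intro b hb
  obtain ⟨w, rfl⟩ := RingQuot.mkAlgHom_surjective F _ b
  rw [AlgHom.comp_apply, fixedPresHom_mk, cycloOfFixedHom_mk] at hb
  have hzero : ∀ γ, FreeAlgebra.lift F (fixedPresGen σ F n α Λ hΛ) w *
      fixedPresGen σ F n α Λ hΛ (.e γ) = 0 := fun γ => by
    obtain ⟨β, k, rfl⟩ := exists_tupClass_eq σ α γ
    have hβ : RingQuot.mkAlgHom F (cycloRel F n Γ Λ β.1)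
        ((FreeAlgebra.lift F (genFix σ F n α) w : QHAOrb σ F n α) β) = 0 :=
      congrFun (congrArg Subtype.val hb) β
    rw [fixedEval_lift] at hβ
    exact lift_mul_eq_zero_of_mk σ F α (satisfies_fixedPresGen σ F n α Λ hΛ)
      (fixedPresGen_cyclo σ F n α Λ hΛ) β w hβ k
  have hsum := satisfies_fixedPresGen σ F n α Λ hΛ _ _ Rel.sum_e
  simp only [map_sum, FreeAlgebra.lift_ι_apply, map_one] at hsum
  rw [← lift_fixedPresGen, ← mul_one (FreeAlgebra.lift F _ w), ← hsum, Finset.mul_sum]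
  exact Finset.sum_eq_zero fun γ _ => hzero γ

end Cyclotomic

end QuiverHecke

theorem mainTheorem5 {K : Type*} {F : Type*} [Field F]
    (Γ : Digraph K) (hΓ : ∀ k, ¬ Γ.Adj k k)
    (p : ℕ) [NeZero p] (ζ : F) (hζ : IsPrimitiveRoot ζ p)
    (σ : QuiverHecke.QuiverAut Γ p)
    (n : ℕ) (α : K →₀ ℕ) (hα : (α.sum fun _ m => m) = n + 1)
    (Λ : K →₀ ℕ) (hΛ : ∀ k, Λ k = Λ (σ.perm k)) :
    (∃ Φ : QuiverHecke.CycloOfFixed σ F n α Λ hΛ ≃ₐ[F] QuiverHecke.fixedCyclo σ F n α Λ hΛ,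
      ∀ h : QuiverHecke.fixedAffine σ F n α,
        (Φ (RingQuot.mkAlgHom F (QuiverHecke.cycloFixRel σ F n α Λ hΛ) h) :
            QuiverHecke.CycloQHAOrb σ F n Λ α) =
          QuiverHecke.projOrb σ F n α Λ h) ∧
    (∃ Ψ : QuiverHecke.FixedPres σ F n α Λ hΛ ≃ₐ[F] QuiverHecke.fixedCyclo σ F n α Λ hΛ,
      (∀ γ : QuiverHecke.OrbClass σ n α,
        (Ψ (QuiverHecke.fixedPresGen σ F n α Λ hΛ (.e γ)) : QuiverHecke.CycloQHAOrb σ F n Λ α) =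
          QuiverHecke.projOrb σ F n α Λ (QuiverHecke.eClass σ F n α γ)) ∧
      (∀ a : Fin (n + 1),
        (Ψ (QuiverHecke.fixedPresGen σ F n α Λ hΛ (.y a)) : QuiverHecke.CycloQHAOrb σ F n Λ α) =
          QuiverHecke.projOrb σ F n α Λ (QuiverHecke.yOrb σ F n α a)) ∧
      (∀ a : Fin n,
        (Ψ (QuiverHecke.fixedPresGen σ F n α Λ hΛ (.psi a)) : QuiverHecke.CycloQHAOrb σ F n Λ α) =
          QuiverHecke.projOrb σ F n α Λ (QuiverHecke.psiOrb σ F n α a))) := by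
  have hcomp := QuiverHecke.cycloOfFixedHom_comp_fixedPresHom_injective σ F n α Λ hΛ
  have hsurj := QuiverHecke.fixedPresHom_surjective σ F n α Λ hΛ
  have hsurj' := QuiverHecke.cycloOfFixedHom_surjective σ F n α Λ hΛ
  have hinj : Function.Injective (QuiverHecke.cycloOfFixedHom σ F n α Λ hΛ) :=
    Function.Injective.of_comp_right (g := QuiverHecke.fixedPresHom σ F n α Λ hΛ) hcomp hsurj
  have hgen : ∀ x, (((QuiverHecke.cycloOfFixedHom σ F n α Λ hΛ).comp
      (QuiverHecke.fixedPresHom σ F n α Λ hΛ) (QuiverHecke.fixedPresGen σ F n α Λ hΛ x) :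
        QuiverHecke.fixedCyclo σ F n α Λ hΛ) : QuiverHecke.CycloQHAOrb σ F n Λ α) =
      QuiverHecke.projOrb σ F n α Λ (QuiverHecke.genFix σ F n α x) := fun x => by
    rw [AlgHom.comp_apply, QuiverHecke.fixedPresGen, QuiverHecke.CycloPres.gen,
      QuiverHecke.fixedPresHom_mk, QuiverHecke.cycloOfFixedHom_mk, FreeAlgebra.lift_ι_apply]
    rfl
  refine ⟨⟨AlgEquiv.ofBijective _ ⟨hinj, hsurj'⟩, fun h => ?_⟩,
    ⟨AlgEquiv.ofBijective _ ⟨hcomp, hsurj'.comp hsurj⟩, fun γ => ?_, fun a => ?_, fun a => ?_⟩⟩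
  · exact congrArg Subtype.val (QuiverHecke.cycloOfFixedHom_mk σ F n α Λ hΛ h)
  · exact hgen (.e γ)
  · exact hgen (.y a)
  · exact hgen (.psi a)
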